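/- Let $\Delta>0$ be an integer, $K=\mathbb{Q}(\sqrt{-\Delta})$, and let $p\neq 2$ be a prime with $\left(\frac{-\Delta}{p}\right)=-1$ (so $p$ is inert in $K$). Let $\mathbb{Z}_{p^2}=\mathbb{Z}_p[\sqrt{-\Delta}]$ and $\mathbb{F}_{p^2}=\mathbb{F}_p[\sqrt{-\Delta}]$; write $x\mapsto\bar x$ for the conjugation $\sqrt{-\Delta}\mapsto-\sqrt{-\Delta}$, $\mathrm{im}$ for the coefficient of $\sqrt{-\Delta}$, and a tilde for reduction modulo $p$. Let $0\le\mathfrak{i}\le g$ be integers. Block matrices of size $g$ have diagonal blocks of sizes $\mathfrak{i},\,g-\mathfrak{i}$, and $E=\mathrm{diag}(1_{\mathfrak{i}},-1_{g-\mathfrak{i}})$. *Open part.* $S(g,\mathfrak{i})^{open}$ consists of the matrices $$\sigma=\begin{pmatrix} p&0&0&pC^t\\ -A&1&C&U\\ 0&0&p&pA^t\\ 0&0&0&p^2\end{pmatrix}$$ (diagonal blocks of sizes $\mathfrak{i},g-\mathfrak{i},\mathfrak{i},g-\mathfrak{i}$), where $A,C$ are integral $(g-\mathfrak{i})\times\mathfrak{i}$-matrices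 and $U$ is an integral $(g-\mathfrak{i})\times(g-\mathfrak{i})$-matrix with $CA^t-AC^t=U-U^t$. (The Hecke correspondence $T_{p,\mathfrak{i}}$ uses those with entries in fixed systems of residues; the statement holds for all of them.) *D-equivalence.* Let $G_V(\mathbb{Z}_p)=GU(\mathfrak{i},g-\mathfrak{i})(\mathbb{Z}_p)$ be the group of matrices $\mathfrak{g}=h+k\sqrt{-\Delta}\in M_g(\mathbb{Z}_{p^2})$ with $\mathfrak{g}E\bar{\mathfrak{g}}^t=\lambda E$ for some $\lambda\in\mathbb{Z}_p^*$, and let $$\alpha(\mathfrak{g})=\begin{pmatrix} h&kE\\-\Delta Ek&EhE\end{pmatrix}\in GSp_{2g}(\mathbb{Z}_p).$$ Then $\sigma_1,\sigma_2$ are D-equivalent iff $\sigma_1\alpha(\mathfrak{g})\sigma_2^{-1}\in GSp_{2g}(\mathbb{Z}_p)$ for some $\mathfrak{g}\in G_V(\mathbb{Z}_p)$. *The stratum.* Put $$\mu_1=\begin{pmatrix}-1&-C^t\sqrt{-\Delta}\\A+C\sqrt{-\Delta}&-1-U\sqrt{-\Delta}\end{pmatrix},\qquad \mu_2=\begin{pmatrix}\sqrt{-\Delta}&-A^t\sqrt{-\Delta}\\A+C\sqrt{-\Delta}&-1-U\sqrt{-\Delta}\end{pmatrix}.$$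 If $\det\tilde\mu_1\neq0$, define $\tilde X_1,\tilde X_2$ by $\tilde\mu_2=\begin{pmatrix}\tilde X_1&\tilde X_2\\0&1\end{pmatrix}\tilde\mu_1$; then $\sigma\in\mathfrak{D}_{\mathfrak{i}}$ iff $\mathrm{rank}\,\mathrm{im}\,\tilde X_1=\mathfrak{i}$. If $\det\tilde\mu_1=0$ and $\det\tilde\mu_2\neq0$, the definition is the same with $\mu_1$ and $\mu_2$ interchanged. If both determinants are $0$ then $\sigma\notin\mathfrak{D}_{\mathfrak{i}}$. The matrix $G=\mu_1E\bar\mu_1^t$ is real; let $G_{22}$ be its lower right $(g-\mathfrak{i})\times(g-\mathfrak{i})$ block, and $G_{22,k}$ that of $\sigma_k$. **Theorem.** Let $\sigma_1,\sigma_2\in\mathfrak{D}_{\mathfrak{i}}\subset S(g,\mathfrak{i})^{open}$. If $g-\mathfrak{i}$ is odd, then $\sigma_1$ and $\sigma_2$ are D-equivalent. If $g-\mathfrak{i}$ is even, then $\sigma_1$ and $\sigma_2$ are D-equivalent if and only if $\det\tilde G_{22,1}/\det\tilde G_{22,2}$ is a square in $\mathbb{F}_p^*$ (the determinant of the empty matrix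 is $1$). -/

import Mathlib

namespace HeckeSiegel

open Matrix

/-- The ring `R[√-Δ]`, with conjugation `star : x + y√-Δ ↦ x - y√-Δ`. When `p` is odd and `-Δ` is not
a square modulo `p`, it is `ℤ_{p²}` (the ring of integers of `K ⊗ ℚ_p`, for `K = ℚ(√-Δ)`) when
`R = ℤ_[p]`, and it is the field `𝔽_{p²}` when `R = ZMod p`. -/
abbrev QExt (R : Type*) [CommRing R] (Δ : ℤ) : Type _ :=
  QuadraticAlgebra R (-(Δ : R)) 0

section Basic

variable {R : Type*} [CommRing R] {Δ : ℤ} {ι κ : Type*}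

/-- The matrix `X + Y√-Δ`. -/
def ofReIm (X Y : Matrix ι κ R) : Matrix ι κ (QExt R Δ) :=
  Matrix.of fun a b => ⟨X a b, Y a b⟩

/-- The real part `X` of a matrix `X + Y√-Δ`. -/
def rePart (M : Matrix ι κ (QExt R Δ)) : Matrix ι κ R := M.map QuadraticAlgebra.re

/-- The imaginary part `Y` of a matrix `X + Y√-Δ`. -/
def imPart (M : Matrix ι κ (QExt R Δ)) : Matrix ι κ R := M.map QuadraticAlgebra.im

/-- The matrix `E = diag(1_i, -1_m)`, with `m = g - i`. -/
def matE (R : Type*) [CommRing R] (i m : ℕ) : Matrix (Fin i ⊕ Fin m) (Fin i ⊕ Fin m) R :=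
  Matrix.fromBlocks 1 0 0 (-1)

/-- `GSp_{2g}(R)`: the matrices that preserve the standard symplectic form up to a unit `c`. -/
def GSp (R : Type*) [CommRing R] (ι : Type*) [Fintype ι] [DecidableEq ι] :
    Set (Matrix (ι ⊕ ι) (ι ⊕ ι) R) :=
  {M | ∃ c : Rˣ, M * Matrix.J ι R * Mᵀ = (c : R) • Matrix.J ι R}

/-- `GU(i, m)(R)`: the matrices `γ` over `R[√-Δ]` such that `γ E γ̄ᵗ = c E` for a unit `c` of `R`. -/
def GU (R : Type*) [CommRing R] (Δ : ℤ) (i m : ℕ) :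
    Set (Matrix (Fin i ⊕ Fin m) (Fin i ⊕ Fin m) (QExt R Δ)) :=
  {γ | ∃ c : Rˣ, γ * matE (QExt R Δ) i m * γᴴ = (c : R) • matE (QExt R Δ) i m}

/-- The embedding of `GU(i, m)` into `GSp_{2g}`, `g = i + m`: it sends `h + k√-Δ` to
`(h, kE; -ΔEk, EhE)`. -/
def alpha {i m : ℕ} (γ : Matrix (Fin i ⊕ Fin m) (Fin i ⊕ Fin m) (QExt R Δ)) :
    Matrix ((Fin i ⊕ Fin m) ⊕ (Fin i ⊕ Fin m)) ((Fin i ⊕ Fin m) ⊕ (Fin i ⊕ Fin m)) R :=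
  Matrix.fromBlocks
    (rePart γ) (imPart γ * matE R i m)
    (-((Δ : R) • (matE R i m * imPart γ))) (matE R i m * rePart γ * matE R i m)

theorem imPart_mul_matE_mul {i m : ℕ} (X Y : Matrix (Fin i ⊕ Fin m) (Fin i ⊕ Fin m) R) :
    imPart (ofReIm (Δ := Δ) X Y * matE (QExt R Δ) i m * (ofReIm X Y)ᴴ) =
      Y * matE R i m * Xᵀ - X * matE R i m * Yᵀ := by
  ext a b
  simp only [imPart, ofReIm, matE, Matrix.map_apply, Matrix.mul_apply, Matrix.sub_apply,
    Matrix.conjTranspose_apply, Matrix.of_apply, Fintype.sum_sum_type, Matrix.fromBlocks_apply₁₁,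
    Matrix.fromBlocks_apply₁₂, Matrix.fromBlocks_apply₂₁, Matrix.fromBlocks_apply₂₂,
    QuadraticAlgebra.im_add, Matrix.transpose_apply]
  simp [Matrix.one_apply, ← QuadraticAlgebra.imₗ_apply, map_sum]
  simp [Finset.sum_add_distrib, Finset.sum_neg_distrib]
  abel_nf

end Basic

/-- The data `(A, C, U)` of an element of `S(g,i)^open`, with `m = g - i`. All integral `A`, `C`, `U` that
satisfy the relation are allowed, and not only those with entries in fixed systems of residues. -/
structure OpenElement (i m : ℕ) where
  A : Matrix (Fin m) (Fin i) ℤ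
  C : Matrix (Fin m) (Fin i) ℤ
  U : Matrix (Fin m) (Fin m) ℤ
  rel : C * Aᵀ - A * Cᵀ = U - Uᵀ

namespace OpenElement

variable {i m : ℕ} (s : OpenElement i m)

/-- The image of `A` in matrices over `R`. -/
def AR (R : Type*) [CommRing R] : Matrix (Fin m) (Fin i) R := s.A.map (Int.cast : ℤ → R)

/-- The image of `C` in matrices over `R`. -/
def CR (R : Type*) [CommRing R] : Matrix (Fin m) (Fin i) R := s.C.map (Int.cast : ℤ → R)

/-- The image of `U` in matrices over `R`. -/
def UR (R : Type*) [CommRing R] : Matrix (Fin m) (Fin m) R := s.U.map (Int.cast : ℤ → R)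

theorem rel_map (R : Type*) [CommRing R] :
    s.CR R * (s.AR R)ᵀ - s.AR R * (s.CR R)ᵀ = s.UR R - (s.UR R)ᵀ := by
  have h := congrArg (fun M => M.map (Int.castRingHom R)) s.rel
  simp only [Matrix.map_sub _ (map_sub (Int.castRingHom R)), Matrix.map_mul] at h
  exact h

/-- The matrix `σ` itself, with entries in `R`; the blocks have sizes `i, m, i, m`. -/
def sigma (R : Type*) [CommRing R] (p : ℕ) :
    Matrix ((Fin i ⊕ Fin m) ⊕ (Fin i ⊕ Fin m)) ((Fin i ⊕ Fin m) ⊕ (Fin i ⊕ Fin m)) R :=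
  Matrix.fromBlocks
    (Matrix.fromBlocks ((p : R) • 1) 0 (-s.AR R) 1)
    (Matrix.fromBlocks 0 ((p : R) • (s.CR R)ᵀ) (s.CR R) (s.UR R))
    0
    (Matrix.fromBlocks ((p : R) • 1) ((p : R) • (s.AR R)ᵀ) 0 ((p : R) ^ 2 • 1))

/-- `μ₁ = (-1, -Cᵗ√-Δ; A + C√-Δ, -1 - U√-Δ)`, with entries in `R[√-Δ]`. -/
def mu₁ (R : Type*) [CommRing R] (Δ : ℤ) :
    Matrix (Fin i ⊕ Fin m) (Fin i ⊕ Fin m) (QExt R Δ) :=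
  ofReIm (Matrix.fromBlocks (-1) 0 (s.AR R) (-1))
    (Matrix.fromBlocks 0 (-(s.CR R)ᵀ) (s.CR R) (-s.UR R))

/-- `μ₂ = (√-Δ, -Aᵗ√-Δ; A + C√-Δ, -1 - U√-Δ)`, with entries in `R[√-Δ]`. -/
def mu₂ (R : Type*) [CommRing R] (Δ : ℤ) :
    Matrix (Fin i ⊕ Fin m) (Fin i ⊕ Fin m) (QExt R Δ) :=
  ofReIm (Matrix.fromBlocks 0 0 (s.AR R) (-1))
    (Matrix.fromBlocks 1 (-(s.AR R)ᵀ) (s.CR R) (-s.UR R))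

/-- `G = μ₁ E μ̄₁ᵗ`, with entries in `R[√-Δ]`. -/
def matG (R : Type*) [CommRing R] (Δ : ℤ) :
    Matrix (Fin i ⊕ Fin m) (Fin i ⊕ Fin m) (QExt R Δ) :=
  s.mu₁ R Δ * matE (QExt R Δ) i m * (s.mu₁ R Δ)ᴴ

/-- `G` is real. -/
theorem imPart_matG (R : Type*) [CommRing R] (Δ : ℤ) : imPart (s.matG R Δ) = 0 := by
  have h := sub_eq_sub_iff_add_eq_add.mp (s.rel_map R)
  rw [matG, mu₁, imPart_mul_matE_mul]
  simp [matE, Matrix.fromBlocks_multiply, Matrix.fromBlocks_transpose, sub_eq_zero]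
  rw [← sub_eq_add_neg, ← sub_eq_add_neg, sub_eq_sub_iff_add_eq_add, h, add_comm]

/-- The lower right `m × m` block of the real matrix `G`, with entries in `R`. -/
def G₂₂ (R : Type*) [CommRing R] (Δ : ℤ) : Matrix (Fin m) (Fin m) R :=
  (rePart (s.matG R Δ)).toBlocks₂₂

end OpenElement

/-- The stratum `𝔇_j` of `S(g,i)^open`. If `det μ̃₁ ≠ 0` then `σ ∈ 𝔇_j` means that `im X̃₁` has rank
`j`, where `μ̃₂ = (X̃₁, X̃₂; 0, 1) μ̃₁`; if `det μ̃₁ = 0 ≠ det μ̃₂` then the roles of `μ₁` and `μ₂` are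
interchanged. The tilde is the reduction modulo `p`. -/
def stratum (p : ℕ) (Δ : ℤ) (i m j : ℕ) : Set (OpenElement i m) :=
  {s |
    ((s.mu₁ (ZMod p) Δ).det ≠ 0 ∧
      ∃ (X₁ : Matrix (Fin i) (Fin i) (QExt (ZMod p) Δ)) (X₂ : Matrix (Fin i) (Fin m) (QExt (ZMod p) Δ)),
        s.mu₂ (ZMod p) Δ = Matrix.fromBlocks X₁ X₂ 0 1 * s.mu₁ (ZMod p) Δ ∧
        (imPart X₁).rank = j) ∨
    ((s.mu₁ (ZMod p) Δ).det = 0 ∧ (s.mu₂ (ZMod p) Δ).det ≠ 0 ∧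
      ∃ (X₁ : Matrix (Fin i) (Fin i) (QExt (ZMod p) Δ)) (X₂ : Matrix (Fin i) (Fin m) (QExt (ZMod p) Δ)),
        s.mu₁ (ZMod p) Δ = Matrix.fromBlocks X₁ X₂ 0 1 * s.mu₂ (ZMod p) Δ ∧
        (imPart X₁).rank = j)}

/-- D-equivalence: there is `γ ∈ GU(i, m)(ℤ_p)` such that `κ = σ₁ α(γ) σ₂⁻¹` lies in `GSp_{2g}(ℤ_p)`,
that is, the double cosets `GSp_{2g}(ℤ_p) σ_k α(GU(i, m)(ℤ_p))`, `k = 1, 2`, coincide. The equation is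
written without the inverse (`σ₂` is invertible over `ℚ_p`). -/
def DEquiv (p : ℕ) [Fact p.Prime] (Δ : ℤ) {i m : ℕ} (s₁ s₂ : OpenElement i m) : Prop :=
  ∃ γ ∈ GU ℤ_[p] Δ i m, ∃ κ ∈ GSp ℤ_[p] (Fin i ⊕ Fin m),
    s₁.sigma ℤ_[p] p * alpha γ = κ * s₂.sigma ℤ_[p] p

end HeckeSiegel

/-!
Write `θ = √-Δ`, `m = g - i`, and let `h(x, y) = x E ȳᵗ` be the standard hermitian form of signature
`(i, m)` on `ℤ_{p²}^g`. The coordinates `(x, y) ↦ -x + y E θ` (`toHerm`) turn `α(γ)` into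
multiplication by `γ̄` and the symplectic form into the imaginary part of `-h`. In these coordinates
the block rows of `σ` are `p a`, `b`, `p c`, `p² d`, where `μ₁` has the block rows `a`, `b` and `μ₂`
has `c`, `b`; the Gram matrix of `b` is the real symmetric matrix `G₂₂`.

On the stratum, `G₂₂` is nondegenerate modulo `p` (`det_ne_zero_of_rank_imPart`): the rank
condition says that no nonzero real combination of the rows of `a` and `c` lies in the
`𝔽_{p²}`-span of `b`. Hence `b` spans a unimodular hermitian lattice over `ℤ_{p²}`, whose
orthogonal complement is again unimodular and so isometric to the standard one, as all units of
`ℤ_p` are norms (`exists_basis_gram_eq`).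

If `T G₂₂(σ₂) Tᵗ = c G₂₂(σ₁)` for some `T ∈ GL_m(ℤ_p)` and some unit `c`, this similarity between the
rows `b` extends to the complements, because `c` is a norm, and gives an element of `GU(i, m)(ℤ_p)`
(`dEquiv_of_congruent`). It maps the lattice of the rows of `σ₁` into that of `σ₂`, since the latter is
its own symplectic dual up to `p²` and all the symplectic products concerned are divisible by `p²`
(`dEquiv_of_rowB_mul_eq`). Conversely a D-equivalence, reduced modulo `p`, yields such a similarity
over `𝔽_p` (`exists_congr_of_dEquiv`), and for even `m` the determinants then differ by a square.

Quadratic forms over `ℤ_p` with unit determinant are classified by their rank and the class of the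
determinant modulo squares (`exists_mul_mul_transpose_eq`). For even `m` this turns the condition on the
determinants into a congruence with `c = 1`; for odd `m` a suitable `c` makes the determinants
agree up to squares in every case. Diagonalization is carried out once, for hermitian forms over a
local ring with involution, and covers both the quadratic forms over `ℤ_p` and the hermitian forms over
`ℤ_{p²}`.
-/

namespace HeckeSiegel

open Matrix

/-! ### Congruence of hermitian matrices -/

section Congruence

variable {S : Type*} [CommRing S] [StarRing S]
variable {ι κ τ ι' κ' : Type*} [Fintype ι] [DecidableEq ι] [Fintype κ] [DecidableEq κ]
  [Fintype τ] [DecidableEq τ] [Fintype ι'] [DecidableEq ι'] [Fintype κ'] [DecidableEq κ']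

/-- `M = P N Pᴴ` for an invertible `P`. The two index types may differ, so that reindexing is a
special case; invertibility of `P` is therefore expressed by a two-sided inverse `Q`. -/
def StarCongruent (M : Matrix ι ι S) (N : Matrix κ κ S) : Prop :=
  ∃ (P : Matrix ι κ S) (Q : Matrix κ ι S), P * Q = 1 ∧ Q * P = 1 ∧ P * N * Pᴴ = M

namespace StarCongruent

theorem refl (M : Matrix ι ι S) : StarCongruent M M :=
  ⟨1, 1, by simp, by simp, by simp⟩

theorem of_eq {M N : Matrix ι ι S} (h : M = N) : StarCongruent M N := h ▸ refl M

theorem symm {M : Matrix ι ι S} {N : Matrix κ κ S} (h : StarCongruent M N) :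
    StarCongruent N M := by
  obtain ⟨P, Q, h1, h2, rfl⟩ := h
  refine ⟨Q, P, h2, h1, ?_⟩
  have h3 : Pᴴ * Qᴴ = 1 := by rw [← conjTranspose_mul, h2, conjTranspose_one]
  rw [← Matrix.mul_assoc, ← Matrix.mul_assoc, h2, Matrix.one_mul, Matrix.mul_assoc, h3,
    Matrix.mul_one]

theorem trans {M : Matrix ι ι S} {N : Matrix κ κ S} {L : Matrix τ τ S}
    (h : StarCongruent M N) (h' : StarCongruent N L) : StarCongruent M L := by
  obtain ⟨P, Q, h1, h2, rfl⟩ := h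
  obtain ⟨P', Q', h1', h2', rfl⟩ := h'
  refine ⟨P * P', Q' * Q, ?_, ?_, ?_⟩
  · rw [Matrix.mul_assoc, ← Matrix.mul_assoc P', h1', Matrix.one_mul, h1]
  · rw [Matrix.mul_assoc, ← Matrix.mul_assoc Q, h2, Matrix.one_mul, h2']
  · simp only [conjTranspose_mul, Matrix.mul_assoc]

theorem submatrix (N : Matrix κ κ S) (e : ι ≃ κ) : StarCongruent (N.submatrix e e) N := by
  refine ⟨(1 : Matrix κ κ S).submatrix e id, (1 : Matrix κ κ S).submatrix id e, ?_, ?_, ?_⟩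
  · ext a b; simp [Matrix.mul_apply, Matrix.one_apply]
  · ext a b
    rw [Matrix.mul_apply, ← e.symm.sum_comp]
    simp [Matrix.one_apply]
  · ext a b; simp [Matrix.mul_apply, Matrix.one_apply]

theorem fromBlocks {M : Matrix ι ι S} {N : Matrix κ κ S} {M' : Matrix ι' ι' S}
    {N' : Matrix κ' κ' S} (h : StarCongruent M N) (h' : StarCongruent M' N') :
    StarCongruent (Matrix.fromBlocks M 0 0 M') (Matrix.fromBlocks N 0 0 N') := by
  obtain ⟨P, Q, h1, h2, rfl⟩ := h
  obtain ⟨P', Q', h1', h2', rfl⟩ := h'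
  refine ⟨Matrix.fromBlocks P 0 0 P', Matrix.fromBlocks Q 0 0 Q', ?_, ?_, ?_⟩
  · simp [fromBlocks_multiply, h1, h1']
  · simp [fromBlocks_multiply, h2, h2']
  · simp [fromBlocks_multiply, fromBlocks_conjTranspose]

theorem diagonal_of_sum (e : ι ⊕ κ ≃ τ) {d d' : τ → S}
    (h : StarCongruent (diagonal fun a => d (e (.inl a))) (diagonal fun a => d' (e (.inl a))))
    (h' : StarCongruent (diagonal fun a => d (e (.inr a))) (diagonal fun a => d' (e (.inr a)))) :
    StarCongruent (diagonal d) (diagonal d') := by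
  have key : ∀ f : τ → S, StarCongruent
      (Matrix.fromBlocks (diagonal fun a => f (e (.inl a))) 0 0 (diagonal fun a => f (e (.inr a))))
      (diagonal f) := fun f => by
    convert submatrix (diagonal f) e using 1
    ext (a | a) (b | b) <;> simp [diagonal_apply]
  exact ((key d).symm.trans (h.fromBlocks h')).trans (key d')

theorem isUnit_det {M : Matrix ι ι S} {N : Matrix κ κ S} (h : StarCongruent M N)
    (hN : IsUnit N.det) : IsUnit M.det := by
  obtain ⟨P, Q, h1, h2, rfl⟩ := h
  have h3 : Pᴴ * Qᴴ = 1 := by rw [← conjTranspose_mul, h2, conjTranspose_one]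
  refine isUnit_det_of_right_inverse (B := Qᴴ * N⁻¹ * Q) ?_
  calc P * N * Pᴴ * (Qᴴ * N⁻¹ * Q) = P * (N * ((Pᴴ * Qᴴ) * N⁻¹)) * Q := by
        simp only [Matrix.mul_assoc]
    _ = 1 := by rw [h3, Matrix.one_mul, mul_nonsing_inv _ hN, Matrix.mul_one, h1]

theorem isHermitian {M : Matrix ι ι S} {N : Matrix κ κ S} (h : StarCongruent M N)
    (hN : N.IsHermitian) : M.IsHermitian := by
  obtain ⟨P, Q, -, -, rfl⟩ := h
  exact isHermitian_mul_mul_conjTranspose P hN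

theorem of_isUnit_det {P M N : Matrix ι ι S} (hP : IsUnit P.det) (h : P * N * Pᴴ = M) :
    StarCongruent M N :=
  ⟨P, P⁻¹, mul_nonsing_inv _ hP, nonsing_inv_mul _ hP, h⟩

theorem exists_isUnit_det {M N : Matrix ι ι S} (h : StarCongruent M N) :
    ∃ P : Matrix ι ι S, IsUnit P.det ∧ P * N * Pᴴ = M := by
  obtain ⟨P, Q, h1, -, h⟩ := h
  exact ⟨P, isUnit_det_of_right_inverse h1, h⟩

end StarCongruent

/-- Completing the square: an invertible diagonal block splits off. -/
theorem starCongruent_schur {A : Matrix ι ι S} (hA : A.IsHermitian) (hdet : IsUnit A.det)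
    (B : Matrix ι κ S) (D : Matrix κ κ S) :
    StarCongruent (fromBlocks A B Bᴴ D) (fromBlocks A 0 0 (D - Bᴴ * A⁻¹ * B)) := by
  have hinv : A⁻¹ᴴ = A⁻¹ := by rw [conjTranspose_nonsing_inv, hA.eq]
  refine ⟨fromBlocks 1 0 (Bᴴ * A⁻¹) 1, fromBlocks 1 0 (-(Bᴴ * A⁻¹)) 1, ?_, ?_, ?_⟩
  · simp [fromBlocks_multiply]
  · simp [fromBlocks_multiply]
  · simp [fromBlocks_multiply, fromBlocks_conjTranspose, hinv, Matrix.mul_assoc, hdet]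

/-- A unimodular hermitian form over a local ring in which `2` is invertible takes a unit value on
some basis vector, after a change of basis. -/
theorem exists_starCongruent_isUnit_apply_zero [IsLocalRing S] (h2 : IsUnit (2 : S)) {n : ℕ}
    (M : Matrix (Fin (n + 1)) (Fin (n + 1)) S) (hM : M.IsHermitian) (hdet : IsUnit M.det) :
    ∃ N : Matrix (Fin (n + 1)) (Fin (n + 1)) S, StarCongruent M N ∧ IsUnit (N 0 0) := by
  by_cases hd : ∃ k, IsUnit (M k k)
  · obtain ⟨k, hk⟩ := hd
    exact ⟨M.submatrix (Equiv.swap 0 k) (Equiv.swap 0 k),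
      (StarCongruent.submatrix M _).symm, by simpa using hk⟩
  push Not at hd
  obtain ⟨j, hj⟩ : ∃ j, IsUnit (M 0 j) := by
    by_contra! hall
    refine (IsLocalRing.mem_maximalIdeal _).1 ?_ hdet
    rw [det_succ_row_zero]
    exact Ideal.sum_mem _ fun j _ => Ideal.mul_mem_right _ _
      (Ideal.mul_mem_left _ _ ((IsLocalRing.mem_maximalIdeal _).2 (hall j)))
  have h0j : (0 : Fin (n + 1)) ≠ j := by
    rintro rfl
    exact hd 0 hj
  obtain ⟨u, hu⟩ := hj
  -- The coefficient is chosen so that the two cross terms add up to `2`.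
  set t : S := star (↑u⁻¹ : S) with ht
  have hP : IsUnit (transvection 0 j t).det := by rw [det_transvection_of_ne _ _ h0j]; exact isUnit_one
  refine ⟨transvection 0 j t * M * (transvection 0 j t)ᴴ,
    (StarCongruent.of_isUnit_det hP rfl).symm, ?_⟩
  have hj0 : M j 0 = star (u : S) := by rw [← hM.apply, hu]
  have hval : (transvection 0 j t * M * (transvection 0 j t)ᴴ) 0 0
      = M 0 0 + (t * star t) * M j j + 2 := by
    have h1 : (transvection 0 j t)ᴴ = 1 + Matrix.single j 0 (star t) := by
      simp [transvection, conjTranspose_add, conjTranspose_single]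
    have e4 : t * star (u : S) = 1 := by rw [ht, ← star_mul, Units.mul_inv, star_one]
    have e5 : (u : S) * star t = 1 := by rw [ht, star_star, Units.mul_inv]
    rw [h1, transvection]
    simp only [Matrix.add_mul, Matrix.mul_add, Matrix.one_mul, Matrix.mul_one, Matrix.add_apply,
      single_mul_apply_same, mul_single_apply_same, hj0, ← hu, e4, e5]
    ring
  rw [hval]
  by_contra hcon
  refine (IsLocalRing.mem_maximalIdeal _).1 ?_ h2
  have h3 := (IsLocalRing.mem_maximalIdeal _).2 hcon
  have h4 : M 0 0 + (t * star t) * M j j ∈ IsLocalRing.maximalIdeal S :=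
    Ideal.add_mem _ ((IsLocalRing.mem_maximalIdeal _).2 (hd 0))
      (Ideal.mul_mem_left _ _ ((IsLocalRing.mem_maximalIdeal _).2 (hd j)))
  simpa using Ideal.sub_mem _ h3 h4

/-- Unimodular hermitian forms over a local ring in which `2` is invertible are diagonalizable. -/
theorem exists_starCongruent_diagonal [IsLocalRing S] (h2 : IsUnit (2 : S)) : ∀ {n : ℕ}
    (M : Matrix (Fin n) (Fin n) S), M.IsHermitian → IsUnit M.det →
    ∃ d : Fin n → S, (∀ k, star (d k) = d k ∧ IsUnit (d k)) ∧ StarCongruent M (diagonal d)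
  | 0, M, _, _ => ⟨0, fun k => k.elim0, by
      rw [Subsingleton.elim M (diagonal 0)]; exact StarCongruent.refl _⟩
  | n + 1, M, hM, hdet => by
    obtain ⟨N, hMN, hN0⟩ := exists_starCongruent_isUnit_apply_zero h2 M hM hdet
    let e : Fin 1 ⊕ Fin n ≃ Fin (n + 1) := finSumFinEquiv.trans (finCongr (add_comm 1 n))
    let L := N.submatrix e e
    have he : e (.inl 0) = 0 := rfl
    have hML : StarCongruent M L := hMN.trans (StarCongruent.submatrix N e).symm
    have hL : L.IsHermitian := hML.symm.isHermitian hM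
    have hA : L.toBlocks₁₁.IsHermitian := by
      ext a b; exact hL.apply _ _
    have hAdet : IsUnit L.toBlocks₁₁.det := by
      rw [det_fin_one]; exact hN0
    have hB : L.toBlocks₂₁ = L.toBlocks₁₂ᴴ := by
      ext a b; exact (hL.apply _ _).symm
    have hL' := starCongruent_schur hA hAdet L.toBlocks₁₂ L.toBlocks₂₂
    rw [← hB, fromBlocks_toBlocks, hB] at hL'
    set D := L.toBlocks₂₂ - L.toBlocks₁₂ᴴ * L.toBlocks₁₁⁻¹ * L.toBlocks₁₂
    have hMD := hML.trans hL'
    have hD : D.IsHermitian := (isHermitian_fromBlocks_iff.1 (hMD.symm.isHermitian hM)).2.2.2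
    have hDdet : IsUnit D.det := by
      have := hMD.symm.isUnit_det hdet
      rw [det_fromBlocks_zero₂₁] at this
      exact isUnit_of_mul_isUnit_right this
    obtain ⟨d, hd, hDd⟩ := exists_starCongruent_diagonal h2 D hD hDdet
    refine ⟨fun k => Sum.elim (fun _ => N 0 0) d (e.symm k), fun k => ?_, ?_⟩
    · rcases h : e.symm k with a | a
      · simp only [h, Sum.elim_inl]
        exact ⟨hL.apply (.inl 0) (.inl 0), hN0⟩
      · simp only [h, Sum.elim_inr]
        exact hd a
    · refine (hMD.trans ((StarCongruent.refl _).fromBlocks hDd)).trans ?_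
      convert StarCongruent.submatrix (diagonal fun k => Sum.elim (fun _ => N 0 0) d (e.symm k)) e
        using 1
      ext (a | a) (b | b)
      · have he' : e.symm 0 = .inl 0 := by rw [← he, e.symm_apply_apply]
        simp [Subsingleton.elim a 0, Subsingleton.elim b 0, L, toBlocks₁₁, he, he']
      · simp
      · simp
      · simp [diagonal_apply]

/-- If every unit fixed by the involution is a norm, then every unimodular hermitian form is
the standard one. -/
theorem starCongruent_one_of_norm_surjective [IsLocalRing S] (h2 : IsUnit (2 : S))
    (hnorm : ∀ u : S, star u = u → IsUnit u → ∃ x, x * star x = u) {n : ℕ}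
    (M : Matrix (Fin n) (Fin n) S) (hM : M.IsHermitian) (hdet : IsUnit M.det) :
    StarCongruent M (1 : Matrix (Fin n) (Fin n) S) := by
  obtain ⟨d, hd, h⟩ := exists_starCongruent_diagonal h2 M hM hdet
  choose x hx using fun k => hnorm (d k) (hd k).1 (hd k).2
  refine h.trans (StarCongruent.of_isUnit_det (P := diagonal x) ?_ ?_)
  · rw [det_diagonal]
    refine IsUnit.prod_univ_iff.2 fun k => ?_
    exact isUnit_of_mul_isUnit_left (y := star (x k)) (by rw [hx]; exact (hd k).2)
  · rw [Matrix.mul_one, diagonal_conjTranspose, diagonal_mul_diagonal]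
    congr 1
    funext k
    exact hx k

/-- If binary unimodular forms represent all units, a unimodular diagonal quadratic form is
congruent to `diag(δ, 1, …, 1)`. -/
theorem exists_starCongruent_mulSingle [TrivialStar S]
    (hrep : ∀ a b : S, IsUnit a → IsUnit b → ∃ x y, a * x ^ 2 + b * y ^ 2 = 1) : ∀ {n : ℕ}
    (d : Fin (n + 1) → S), (∀ k, IsUnit (d k)) →
    ∃ δ, IsUnit δ ∧ StarCongruent (diagonal d) (diagonal (Pi.mulSingle (0 : Fin (n + 1)) δ))
  | 0, d, hd => ⟨d 0, hd 0, by
      refine StarCongruent.of_eq (congrArg diagonal (funext fun k => ?_))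
      obtain rfl : k = 0 := Fin.fin_one_eq_zero k
      rw [Pi.mulSingle_eq_same]⟩
  | n + 1, d, hd => by
    obtain ⟨δ, hδ, h⟩ := exists_starCongruent_mulSingle hrep (fun k => d k.succ) fun k => hd _
    obtain ⟨x, y, hxy⟩ := hrep (d 0) δ (hd 0) hδ
    refine ⟨d 0 * δ, (hd 0).mul hδ, ?_⟩
    let e₁ : Fin 1 ⊕ Fin (n + 1) ≃ Fin (n + 2) := finSumFinEquiv.trans (finCongr (add_comm 1 _))
    let e₂ : Fin 2 ⊕ Fin n ≃ Fin (n + 2) := finSumFinEquiv.trans (finCongr (add_comm 2 _))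
    have he₁ : ∀ k, e₁ (.inr k) = k.succ := fun k => by
      ext; simp [e₁]
    have he₂ : ∀ k, e₂ (.inr k) = k.succ.succ := fun k => by
      ext; simp [e₂]
    let d' : Fin (n + 2) → S := Fin.cons (d 0) (Pi.mulSingle (0 : Fin (n + 1)) δ)
    have s₁ : StarCongruent (diagonal d) (diagonal d') := by
      refine StarCongruent.diagonal_of_sum e₁ ?_ ?_
      · refine StarCongruent.of_eq (congrArg diagonal (funext fun a => ?_))
        rw [Subsingleton.elim a 0]
        rfl
      · simpa only [he₁, d', Fin.cons_succ] using h
    refine s₁.trans (StarCongruent.diagonal_of_sum e₂ ?_ ?_)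
    · have h0 : e₂ (.inl 0) = 0 := rfl
      have h1 : e₂ (.inl 1) = Fin.succ 0 := rfl
      -- An orthogonal basis of the plane whose second vector has the value `1`.
      refine (StarCongruent.of_isUnit_det (P := !![-(δ * y), d 0 * x; x, y]) ?_ ?_).symm
      · rw [det_fin_two_of, show -(δ * y) * y - d 0 * x * x = -(d 0 * x ^ 2 + δ * y ^ 2) by ring, hxy]
        exact isUnit_one.neg
      · have key : (diagonal fun a => d' (e₂ (.inl a))) = !![d 0, 0; 0, δ] := by
          ext a b
          fin_cases a <;> fin_cases b <;> simp [h0, h1, d']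
        have key' : (diagonal fun a => Pi.mulSingle (M := fun _ => S) (0 : Fin (n + 2)) (d 0 * δ) (e₂ (.inl a)))
            = !![d 0 * δ, 0; 0, 1] := by
          ext a b
          fin_cases a <;> fin_cases b <;> simp [h0, h1]
        rw [key, key']
        ext a b
        fin_cases a <;> fin_cases b <;>
          simp [Matrix.mul_apply, Fin.sum_univ_two]
        · linear_combination d 0 * δ * hxy
        · ring
        · ring
        · linear_combination hxy
    · refine StarCongruent.of_eq (congrArg diagonal (funext fun a => ?_))
      simp [he₂, d']

/-- Unimodular quadratic forms of the same rank whose discriminants agree up to the square of a unit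
are congruent, if binary unimodular forms represent all units. -/
theorem starCongruent_of_det_eq [IsLocalRing S] [TrivialStar S] (h2 : IsUnit (2 : S))
    (hrep : ∀ a b : S, IsUnit a → IsUnit b → ∃ x y, a * x ^ 2 + b * y ^ 2 = 1) {n : ℕ}
    {M N : Matrix (Fin n) (Fin n) S} (hM : M.IsHermitian) (hN : N.IsHermitian)
    (hMdet : IsUnit M.det) (hNdet : IsUnit N.det) {v : S} (hMN : M.det = v ^ 2 * N.det) :
    StarCongruent M N := by
  rcases n with - | n
  · rw [Subsingleton.elim M N]; exact StarCongruent.refl _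
  obtain ⟨d, hd, hMd⟩ := exists_starCongruent_diagonal h2 M hM hMdet
  obtain ⟨d', hd', hNd⟩ := exists_starCongruent_diagonal h2 N hN hNdet
  obtain ⟨δ, hδ, hdδ⟩ := exists_starCongruent_mulSingle hrep d fun k => (hd k).2
  obtain ⟨δ', hδ', hdδ'⟩ := exists_starCongruent_mulSingle hrep d' fun k => (hd' k).2
  have hM' := hMd.trans hdδ
  have hN' := hNd.trans hdδ'
  refine hM'.trans (StarCongruent.trans ?_ hN'.symm)
  obtain ⟨P, hP, rfl⟩ := hM'.exists_isUnit_det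
  obtain ⟨P', hP', rfl⟩ := hN'.exists_isUnit_det
  have hprod : ∀ z : S, (diagonal (Pi.mulSingle (0 : Fin (n + 1)) z)).det = z := fun z => by
    rw [det_diagonal, Fin.prod_univ_succ]; simp
  simp only [det_mul, det_conjTranspose, hprod, star_trivial] at hMN hMdet
  have hv : IsUnit v := by
    rw [hMN] at hMdet
    exact (isUnit_pow_iff two_ne_zero).1 (isUnit_of_mul_isUnit_left hMdet)
  obtain ⟨q, hq⟩ := hP
  set w : S := ↑q⁻¹ * v * P'.det with hw
  have hwδ : δ = w ^ 2 * δ' := by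
    have e : (↑q⁻¹ : S) * q = 1 := q.inv_mul
    rw [← hq] at hMN
    calc δ = ↑q⁻¹ * ↑q * δ * (↑q⁻¹ * ↑q) := by rw [e]; ring
      _ = ↑q⁻¹ ^ 2 * (↑q * δ * ↑q) := by ring
      _ = w ^ 2 * δ' := by rw [hMN, hw]; ring
  refine StarCongruent.of_isUnit_det (P := diagonal (Pi.mulSingle (0 : Fin (n + 1)) w)) ?_ ?_
  · rw [hprod]
    exact ((q⁻¹).isUnit.mul hv).mul hP'
  · rw [diagonal_conjTranspose, diagonal_mul_diagonal, diagonal_mul_diagonal]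
    congr 1
    funext k
    refine Fin.cases ?_ (fun k => ?_) k
    · simp [star_trivial, hwδ]; ring
    · simp

end Congruence

/-! ### Squares and norms over the `p`-adic integers -/

section Padic

variable {p : ℕ} [Fact p.Prime]

theorem isUnit_iff_toZMod_ne_zero {x : ℤ_[p]} : IsUnit x ↔ PadicInt.toZMod x ≠ 0 := by
  rw [ne_eq, ← RingHom.mem_ker, PadicInt.ker_toZMod, IsLocalRing.mem_maximalIdeal, mem_nonunits_iff,
    not_not]

theorem isUnit_two (hp2 : p ≠ 2) : IsUnit (2 : ℤ_[p]) := by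
  rw [isUnit_iff_toZMod_ne_zero, map_ofNat]
  have h : Fact (2 < p) := ⟨lt_of_le_of_ne (Fact.out : p.Prime).two_le hp2.symm⟩
  exact Ring.two_ne_zero (by rwa [ZMod.ringChar_zmod_n])

/-- Hensel's lemma for squares. -/
theorem exists_sq_eq_of_toZMod (hp2 : p ≠ 2) {u : ℤ_[p]} {c : ZMod p} (hc : c ≠ 0)
    (h : PadicInt.toZMod u = c ^ 2) : ∃ v, v ^ 2 = u := by
  obtain ⟨a, rfl⟩ := ZMod.ringHom_surjective (PadicInt.toZMod (p := p)) c
  have ha := (isUnit_two hp2).mul (isUnit_iff_toZMod_ne_zero.2 hc)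
  have hau : ‖a ^ 2 - u‖ < 1 := by
    rw [← PadicInt.mem_nonunits, mem_nonunits_iff, isUnit_iff_toZMod_ne_zero, not_not]
    simp [h]
  obtain ⟨z, hz, -⟩ := hensels_lemma (F := (Polynomial.X ^ 2 - Polynomial.C u : Polynomial ℤ_[p]))
    (a := a) (by
      simpa [one_add_one_eq_two, PadicInt.isUnit_iff.1 ha, PadicInt.isUnit_iff.1 (isUnit_two hp2),
        PadicInt.isUnit_iff.1 (isUnit_iff_toZMod_ne_zero.2 hc)] using hau)
  exact ⟨z, by simpa [sub_eq_zero] using hz⟩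

/-- A unimodular binary quadratic form over `ℤ_p` represents `1`: it does so modulo `p` by counting,
and a coordinate that is a unit can be adjusted by Hensel's lemma. -/
theorem exists_binary_eq_one (hp2 : p ≠ 2) (a b : ℤ_[p]) (ha : IsUnit a) (hb : IsUnit b) :
    ∃ x y, a * x ^ 2 + b * y ^ 2 = 1 := by
  have key : ∀ a b x y : ℤ_[p], IsUnit a → PadicInt.toZMod x ≠ 0 →
      PadicInt.toZMod (a * x ^ 2 + b * y ^ 2) = 1 → ∃ x y, a * x ^ 2 + b * y ^ 2 = 1 := by
    rintro a b x y ⟨a, rfl⟩ hx h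
    obtain ⟨v, hv⟩ := exists_sq_eq_of_toZMod hp2 (u := ↑a⁻¹ * (1 - b * y ^ 2)) hx (by
      have e : (a * x ^ 2 + b * y ^ 2 - 1 : ℤ_[p]) ∈ RingHom.ker (PadicInt.toZMod (p := p)) := by
        rw [RingHom.mem_ker, map_sub, h, map_one, sub_self]
      rw [← map_pow, ← sub_eq_zero, ← map_sub, ← RingHom.mem_ker]
      convert Ideal.mul_mem_left _ (-(↑a⁻¹ : ℤ_[p])) e using 1
      have := a.inv_mul
      linear_combination (x ^ 2) * this)
    refine ⟨v, y, ?_⟩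
    rw [hv, a.mul_inv_cancel_left]
    ring
  have ha' := isUnit_iff_toZMod_ne_zero.1 ha
  have hb' := isUnit_iff_toZMod_ne_zero.1 hb
  obtain ⟨x, y, hxy⟩ := FiniteField.exists_root_sum_quadratic (R := ZMod p)
    (f := Polynomial.C (PadicInt.toZMod a) * Polynomial.X ^ 2)
    (g := Polynomial.C (PadicInt.toZMod b) * Polynomial.X ^ 2 + Polynomial.C 0 * Polynomial.X
      + Polynomial.C (-1))
    (Polynomial.degree_C_mul_X_pow 2 ha')
    (Polynomial.degree_quadratic hb')
    (by rw [ZMod.card]; exact (Fact.out : p.Prime).eq_two_or_odd.resolve_left hp2)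
  obtain ⟨x, rfl⟩ := ZMod.ringHom_surjective (PadicInt.toZMod (p := p)) x
  obtain ⟨y, rfl⟩ := ZMod.ringHom_surjective (PadicInt.toZMod (p := p)) y
  have h : PadicInt.toZMod (a * x ^ 2 + b * y ^ 2) = 1 := by
    simp only [Polynomial.eval_add, Polynomial.eval_mul, Polynomial.eval_C, Polynomial.eval_pow,
      Polynomial.eval_X] at hxy
    simp only [map_add, map_mul, map_pow]
    linear_combination hxy
  by_cases hx : PadicInt.toZMod x = 0
  · have hy : PadicInt.toZMod y ≠ 0 := by
      intro hy
      simp [hx, hy] at h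
    obtain ⟨y, x, h⟩ := key b a y x hb hy (by rwa [add_comm])
    exact ⟨x, y, by rwa [add_comm]⟩
  · exact key a b x y ha hx h

/-- Unimodular quadratic forms over `ℤ_p`, `p` odd, are classified by rank and discriminant. -/
theorem exists_mul_mul_transpose_eq (hp2 : p ≠ 2) {n : ℕ} {M N : Matrix (Fin n) (Fin n) ℤ_[p]}
    (hM : Mᵀ = M) (hN : Nᵀ = N) (hMdet : IsUnit M.det) (hNdet : IsUnit N.det) {v : ℤ_[p]}
    (hMN : M.det = v ^ 2 * N.det) :
    ∃ P : Matrix (Fin n) (Fin n) ℤ_[p], IsUnit P.det ∧ P * N * Pᵀ = M := by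
  let : StarRing ℤ_[p] := starRingOfComm
  let : TrivialStar ℤ_[p] := ⟨fun _ => rfl⟩
  have h : ∀ L : Matrix (Fin n) (Fin n) ℤ_[p], Lᴴ = Lᵀ := conjTranspose_eq_transpose_of_trivial
  obtain ⟨P, hP, hPM⟩ := (starCongruent_of_det_eq (isUnit_two hp2) (exists_binary_eq_one hp2)
    ((h M).trans hM) ((h N).trans hN) hMdet hNdet hMN).exists_isUnit_det
  exact ⟨P, hP, by rwa [← h]⟩

end Padic

section QExt

/-- The ring homomorphism `R[√-Δ] → R'[√-Δ]` induced by `R → R'`. -/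
def mapQExt {R R' : Type*} [CommRing R] [CommRing R'] (f : R →+* R') (Δ : ℤ) :
    QExt R Δ →+* QExt R' Δ where
  toFun z := ⟨f z.re, f z.im⟩
  map_one' := QuadraticAlgebra.ext (map_one f) (map_zero f)
  map_mul' z w := by ext <;> simp
  map_zero' := by ext <;> simp
  map_add' z w := by ext <;> simp

variable {p : ℕ} [Fact p.Prime] {Δ : ℤ}

theorem sq_add_mul_sq_eq_zero (hinert : legendreSym p (-Δ) = -1) {x y : ZMod p}
    (h : x * x + Δ * y * y = 0) : x = 0 ∧ y = 0 := by
  have hns := (legendreSym.eq_neg_one_iff p).1 hinert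
  have hy : y = 0 := by
    by_contra hy
    refine hns ⟨x / y, ?_⟩
    field_simp
    push_cast
    linear_combination -h
  subst hy
  simpa using h

theorem isUnit_zmod_of_ne_zero (hinert : legendreSym p (-Δ) = -1) {z : QExt (ZMod p) Δ}
    (hz : z ≠ 0) : IsUnit z := by
  rw [QuadraticAlgebra.isUnit_iff_norm_isUnit, isUnit_iff_ne_zero, QuadraticAlgebra.norm_def]
  intro h
  obtain ⟨h1, h2⟩ := sq_add_mul_sq_eq_zero hinert (x := z.re) (y := z.im) (by linear_combination h)
  exact hz (QuadraticAlgebra.ext h1 h2)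

theorem isUnit_iff_mapQExt_ne_zero (hinert : legendreSym p (-Δ) = -1) {z : QExt ℤ_[p] Δ} :
    IsUnit z ↔ mapQExt PadicInt.toZMod Δ z ≠ 0 := by
  refine ⟨fun h => (h.map _).ne_zero, fun h => ?_⟩
  have h1 := QuadraticAlgebra.isUnit_iff_norm_isUnit.1 (isUnit_zmod_of_ne_zero hinert h)
  rw [QuadraticAlgebra.isUnit_iff_norm_isUnit, isUnit_iff_toZMod_ne_zero]
  convert h1.ne_zero using 1
  simp [QuadraticAlgebra.norm_def, mapQExt]

theorem isLocalRing_qExt (hinert : legendreSym p (-Δ) = -1) : IsLocalRing (QExt ℤ_[p] Δ) := by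
  refine IsLocalRing.of_nonunits_add fun a b ha hb => ?_
  rw [mem_nonunits_iff, isUnit_iff_mapQExt_ne_zero hinert, not_not] at *
  rw [map_add, ha, hb, add_zero]

/-- The norm from `ℤ_{p²}` is surjective on units. -/
theorem exists_mul_star_eq (hp2 : p ≠ 2) (hinert : legendreSym p (-Δ) = -1) {c : ℤ_[p]}
    (hc : IsUnit c) : ∃ z : QExt ℤ_[p] Δ, z * star z = algebraMap _ _ c := by
  have hΔ : IsUnit (Δ : ℤ_[p]) := by
    rw [isUnit_iff_toZMod_ne_zero, map_intCast]
    intro h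
    simpa using sq_add_mul_sq_eq_zero (x := 0) (y := 1) hinert (by simp [h])
  obtain ⟨c, rfl⟩ := hc
  obtain ⟨x, y, h⟩ := exists_binary_eq_one hp2 (↑c⁻¹ : ℤ_[p]) (↑c⁻¹ * Δ) c⁻¹.isUnit
    (c⁻¹.isUnit.mul hΔ)
  refine ⟨⟨x, y⟩, ?_⟩
  rw [← QuadraticAlgebra.algebraMap_norm_eq_mul_star, QuadraticAlgebra.norm_def]
  congr 1
  have := c.mul_inv
  linear_combination (c : ℤ_[p]) * h - (x ^ 2 + Δ * y ^ 2) * this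

theorem starCongruent_one (hp2 : p ≠ 2) (hinert : legendreSym p (-Δ) = -1) {n : ℕ}
    {M : Matrix (Fin n) (Fin n) (QExt ℤ_[p] Δ)} (hM : M.IsHermitian) (hdet : IsUnit M.det) :
    StarCongruent M (1 : Matrix (Fin n) (Fin n) (QExt ℤ_[p] Δ)) := by
  have := isLocalRing_qExt hinert
  refine starCongruent_one_of_norm_surjective ?_ (fun u hu hunit => ?_) M hM hdet
  · have h := (isUnit_two hp2).map (algebraMap ℤ_[p] (QExt ℤ_[p] Δ))
    rwa [map_ofNat] at h
  · have him : u.im = 0 := by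
      have h : -u.im = u.im := congrArg QuadraticAlgebra.im hu
      have h2 : (2 : ℤ_[p]) * u.im = 0 := by linear_combination -h
      exact ((isUnit_two hp2).mul_right_eq_zero).1 h2
    have hre : u = algebraMap _ _ u.re := QuadraticAlgebra.ext rfl him
    rw [hre] at hunit ⊢
    refine exists_mul_star_eq hp2 hinert ?_
    have := QuadraticAlgebra.isUnit_iff_norm_isUnit.1 hunit
    rw [QuadraticAlgebra.norm_algebraMap] at this
    exact (isUnit_pow_iff two_ne_zero).1 this

end QExt

/-! ### The hermitian space behind the symplectic space -/

section Hermitian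

variable {R : Type*} [CommRing R] {Δ : ℤ} {ι κ τ : Type*}

@[simp] theorem rePart_ofReIm (X Y : Matrix ι κ R) : rePart (ofReIm (Δ := Δ) X Y) = X := rfl

@[simp] theorem imPart_ofReIm (X Y : Matrix ι κ R) : imPart (ofReIm (Δ := Δ) X Y) = Y := rfl

theorem ofReIm_rePart_imPart (M : Matrix ι κ (QExt R Δ)) : ofReIm (rePart M) (imPart M) = M := rfl

theorem ofReIm_rePart {M : Matrix ι κ (QExt R Δ)} (h : imPart M = 0) : ofReIm (rePart M) 0 = M := by
  rw [← h, ofReIm_rePart_imPart]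

theorem ofReIm_zero : ofReIm (0 : Matrix ι κ R) 0 = (0 : Matrix ι κ (QExt R Δ)) := rfl

theorem ofReIm_one [DecidableEq ι] : ofReIm (1 : Matrix ι ι R) 0 = (1 : Matrix ι ι (QExt R Δ)) := by
  ext a b <;> by_cases h : a = b <;> simp [ofReIm, one_apply, h, QuadraticAlgebra.re_one,
    QuadraticAlgebra.im_one]

theorem ofReIm_mul [Fintype κ] (X Y : Matrix ι κ R) (X' Y' : Matrix κ τ R) :
    ofReIm (Δ := Δ) X Y * ofReIm (Δ := Δ) X' Y' =
      ofReIm (X * X' - (Δ : R) • (Y * Y')) (X * Y' + Y * X') := by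
  ext a b
  · change QuadraticAlgebra.reₗ _ _ _ = _
    simp only [mul_apply, map_sum, ofReIm, of_apply, Matrix.sub_apply, Matrix.smul_apply, smul_eq_mul,
      Finset.mul_sum, ← Finset.sum_sub_distrib]
    refine Finset.sum_congr rfl fun k _ => ?_
    simp [mul_assoc, sub_eq_add_neg]
  · change QuadraticAlgebra.imₗ _ _ _ = _
    simp only [mul_apply, map_sum, ofReIm, of_apply, Matrix.add_apply, ← Finset.sum_add_distrib]
    refine Finset.sum_congr rfl fun k _ => ?_
    simp

theorem ofReIm_conjTranspose (X Y : Matrix ι κ R) :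
    (ofReIm (Δ := Δ) X Y)ᴴ = ofReIm Xᵀ (-Yᵀ) := by
  ext a b <;> simp [ofReIm]

theorem ofReIm_map_star (X Y : Matrix ι κ R) :
    (ofReIm (Δ := Δ) X Y).map star = ofReIm X (-Y) := by
  ext a b <;> simp [ofReIm]

theorem smul_ofReIm (c : R) (X Y : Matrix ι κ R) :
    c • ofReIm (Δ := Δ) X Y = ofReIm (c • X) (c • Y) := rfl

theorem ofReIm_injective {X Y X' Y' : Matrix ι κ R}
    (h : ofReIm (Δ := Δ) X Y = ofReIm X' Y') : X = X' ∧ Y = Y' :=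
  ⟨congrArg rePart h, congrArg imPart h⟩

theorem imPart_ofReIm_zero_mul [Fintype κ] (K : Matrix ι κ R) (M : Matrix κ τ (QExt R Δ)) :
    imPart (ofReIm (Δ := Δ) K 0 * M) = K * imPart M := by
  rw [← ofReIm_rePart_imPart M, ofReIm_mul]; simp

theorem imPart_mul_ofReIm_zero [Fintype κ] (M : Matrix ι κ (QExt R Δ)) (K : Matrix κ τ R) :
    imPart (M * ofReIm (Δ := Δ) K 0) = imPart M * K := by
  rw [← ofReIm_rePart_imPart M, ofReIm_mul]; simp

theorem imPart_conjTranspose (M : Matrix ι κ (QExt R Δ)) : imPart Mᴴ = -(imPart M)ᵀ := by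
  rw [← ofReIm_rePart_imPart M, ofReIm_conjTranspose]; simp

theorem isUnit_det_ofReIm [Fintype ι] [DecidableEq ι] {H : Matrix ι ι R} (h : IsUnit H.det) :
    IsUnit (ofReIm (Δ := Δ) H 0).det := by
  refine isUnit_det_of_right_inverse (B := ofReIm (Δ := Δ) H⁻¹ 0) ?_
  rw [ofReIm_mul, mul_nonsing_inv _ h]
  simp [ofReIm_one]

section E

variable {i m : ℕ}

theorem matE_eq_ofReIm : matE (QExt R Δ) i m = ofReIm (matE R i m) 0 := by
  have h : matE (QExt R Δ) i m = fromBlocks (ofReIm 1 0) 0 0 (-ofReIm 1 0) := by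
    rw [matE, ofReIm_one, ofReIm_one]
  rw [h]
  ext (a | a) (b | b) <;> simp [matE, ofReIm]

theorem matE_mul_matE : matE R i m * matE R i m = 1 := by
  simp [matE, fromBlocks_multiply]

theorem matE_transpose : (matE R i m)ᵀ = matE R i m := by
  simp [matE, fromBlocks_transpose]

theorem matE_conjTranspose : (matE (QExt R Δ) i m)ᴴ = matE (QExt R Δ) i m := by
  simp [matE, fromBlocks_conjTranspose]

theorem isUnit_det_matE : IsUnit (matE R i m).det :=
  isUnit_det_of_right_inverse matE_mul_matE

theorem imPart_ofReIm_mul_matE_mul (X Y : Matrix ι (Fin i ⊕ Fin m) R)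
    (X' Y' : Matrix κ (Fin i ⊕ Fin m) R) :
    imPart (ofReIm (Δ := Δ) X Y * matE (QExt R Δ) i m * (ofReIm (Δ := Δ) X' Y')ᴴ) =
      Y * matE R i m * X'ᵀ - X * matE R i m * Y'ᵀ := by
  rw [matE_eq_ofReIm, ofReIm_conjTranspose, ofReIm_mul, ofReIm_mul]
  simp [sub_eq_neg_add]

/-- The coordinates on `R^{2g}` in which `alpha` becomes multiplication in `R[√-Δ]^g`: the row
`(x, y)` corresponds to `-x + y E √-Δ`. This is the negative conjugate of the more obvious
`x + y E √-Δ`; it turns the first three block rows of `σ`, divided by the appropriate powers of `p`,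
into the rows of `μ₁` and `μ₂`. -/
def toHerm (M : Matrix κ ((Fin i ⊕ Fin m) ⊕ (Fin i ⊕ Fin m)) R) :
    Matrix κ (Fin i ⊕ Fin m) (QExt R Δ) :=
  ofReIm (-M.toCols₁) (M.toCols₂ * matE R i m)

theorem toHerm_mul [Fintype κ] (K : Matrix ι κ R)
    (M : Matrix κ ((Fin i ⊕ Fin m) ⊕ (Fin i ⊕ Fin m)) R) :
    toHerm (Δ := Δ) (K * M) = ofReIm (Δ := Δ) K 0 * toHerm (Δ := Δ) M := by
  have h1 : (K * M).toCols₁ = K * M.toCols₁ := rfl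
  have h2 : (K * M).toCols₂ = K * M.toCols₂ := rfl
  rw [toHerm, toHerm, ofReIm_mul, h1, h2]
  simp [Matrix.mul_assoc]

theorem toHerm_mul_alpha (M : Matrix κ ((Fin i ⊕ Fin m) ⊕ (Fin i ⊕ Fin m)) R)
    (γ : Matrix (Fin i ⊕ Fin m) (Fin i ⊕ Fin m) (QExt R Δ)) :
    toHerm (Δ := Δ) (M * alpha γ) = toHerm (Δ := Δ) M * γ.map star := by
  have hγ : γ.map star = ofReIm (rePart γ) (-imPart γ) := by
    rw [← ofReIm_map_star, ofReIm_rePart_imPart]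
  obtain ⟨X, Y, rfl⟩ : ∃ X Y, M = fromCols X Y := ⟨_, _, (fromCols_toCols M).symm⟩
  rw [hγ, alpha, fromCols_mul_fromBlocks, toHerm, toHerm, ofReIm_mul]
  simp only [toCols₁_fromCols, toCols₂_fromCols]
  congr 1
  · simp [Matrix.mul_assoc, add_comm]
  · simp [Matrix.add_mul, Matrix.mul_assoc, matE_mul_matE]

/-- The symplectic form is, up to sign, the imaginary part of the hermitian form. -/
theorem imPart_toHerm (M : Matrix ι ((Fin i ⊕ Fin m) ⊕ (Fin i ⊕ Fin m)) R)
    (N : Matrix κ ((Fin i ⊕ Fin m) ⊕ (Fin i ⊕ Fin m)) R) :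
    imPart (toHerm (Δ := Δ) M * matE (QExt R Δ) i m * (toHerm (Δ := Δ) N)ᴴ) =
      -(M * Matrix.J (Fin i ⊕ Fin m) R * Nᵀ) := by
  obtain ⟨X, Y, rfl⟩ : ∃ X Y, M = fromCols X Y := ⟨_, _, (fromCols_toCols M).symm⟩
  obtain ⟨X', Y', rfl⟩ : ∃ X Y, N = fromCols X Y := ⟨_, _, (fromCols_toCols N).symm⟩
  rw [toHerm, toHerm, imPart_ofReIm_mul_matE_mul, Matrix.J, fromCols_mul_fromBlocks,
    transpose_fromCols, fromCols_mul_fromRows]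
  simp only [toCols₁_fromCols, toCols₂_fromCols]
  have h1 : Y * matE R i m * matE R i m = Y := by rw [Matrix.mul_assoc, matE_mul_matE, Matrix.mul_one]
  have h2 : matE R i m * (matE R i m * Y'ᵀ) = Y'ᵀ := by
    rw [← Matrix.mul_assoc, matE_mul_matE, Matrix.one_mul]
  simp [h1, h2, Matrix.mul_assoc, matE_transpose]
  abel

theorem mem_GU_map_star {γ : Matrix (Fin i ⊕ Fin m) (Fin i ⊕ Fin m) (QExt R Δ)} {c : R}
    (h : γ * matE (QExt R Δ) i m * γᴴ = c • matE (QExt R Δ) i m) :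
    γ.map star * matE (QExt R Δ) i m * (γ.map star)ᴴ = c • matE (QExt R Δ) i m := by
  have h' := congrArg (fun M => M.map (starRingEnd (QExt R Δ))) h
  have e : (c • matE (QExt R Δ) i m).map (starRingEnd (QExt R Δ)) = c • matE (QExt R Δ) i m := by
    change (c • matE (QExt R Δ) i m).map star = _
    rw [matE_eq_ofReIm, smul_ofReIm, ofReIm_map_star]
    simp
  have e' : (matE (QExt R Δ) i m).map (starRingEnd (QExt R Δ)) = matE (QExt R Δ) i m := by
    change (matE (QExt R Δ) i m).map star = _
    rw [matE_eq_ofReIm, ofReIm_map_star, neg_zero]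
  simp only [e, Matrix.map_mul, e'] at h'
  exact h'

end E

end Hermitian

namespace OpenElement

variable {i m : ℕ} (s : OpenElement i m) (R : Type*) [CommRing R] (Δ : ℤ)

/-- The upper block row of `μ₁`. -/
def rowA : Matrix (Fin i) (Fin i ⊕ Fin m) (QExt R Δ) :=
  ofReIm (fromCols (-1) 0) (fromCols 0 (-(s.CR R)ᵀ))

/-- The lower block row that `μ₁` and `μ₂` have in common. -/
def rowB : Matrix (Fin m) (Fin i ⊕ Fin m) (QExt R Δ) :=
  ofReIm (fromCols (s.AR R) (-1)) (fromCols (s.CR R) (-s.UR R))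

/-- The upper block row of `μ₂`. -/
def rowC : Matrix (Fin i) (Fin i ⊕ Fin m) (QExt R Δ) :=
  ofReIm 0 (fromCols 1 (-(s.AR R)ᵀ))

/-- The last block row of `σ`, divided by `p²`, in the coordinates `toHerm`. -/
def rowD (i m : ℕ) (R : Type*) [CommRing R] (Δ : ℤ) : Matrix (Fin m) (Fin i ⊕ Fin m) (QExt R Δ) :=
  ofReIm 0 (fromCols 0 (-1))

theorem mu₁_eq : s.mu₁ R Δ = fromRows (s.rowA R Δ) (s.rowB R Δ) := by
  ext (a | a) (b | b) <;> rfl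

theorem mu₂_eq : s.mu₂ R Δ = fromRows (s.rowC R Δ) (s.rowB R Δ) := by
  ext (a | a) (b | b) <;> rfl

theorem toHerm_sigma (p : ℕ) : toHerm (Δ := Δ) (s.sigma R p) =
    fromRows (fromRows ((p : R) • s.rowA R Δ) (s.rowB R Δ))
      (fromRows ((p : R) • s.rowC R Δ) ((p : R) ^ 2 • rowD i m R Δ)) := by
  have h1 : (s.sigma R p).toCols₁ = fromRows (fromBlocks ((p : R) • 1) 0 (-s.AR R) 1) 0 := by
    ext (a | a) b <;> rfl
  have h2 : (s.sigma R p).toCols₂ = fromRows (fromBlocks 0 ((p : R) • (s.CR R)ᵀ) (s.CR R) (s.UR R))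
      (fromBlocks ((p : R) • 1) ((p : R) • (s.AR R)ᵀ) 0 ((p : R) ^ 2 • 1)) := by
    ext (a | a) b <;> rfl
  rw [toHerm, h1, h2, fromRows_mul, matE, fromBlocks_multiply, fromBlocks_multiply]
  ext ((a | a) | (a | a)) (b | b) <;> simp [rowA, rowB, rowC, rowD, ofReIm]

theorem imPart_rowA_rowB :
    imPart (s.rowA R Δ * matE (QExt R Δ) i m * (s.rowB R Δ)ᴴ) = 0 := by
  rw [rowA, rowB, imPart_ofReIm_mul_matE_mul, matE]
  simp [fromCols_mul_fromBlocks, transpose_fromCols, fromCols_mul_fromRows]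

theorem imPart_rowC_rowB :
    imPart (s.rowC R Δ * matE (QExt R Δ) i m * (s.rowB R Δ)ᴴ) = 0 := by
  rw [rowC, rowB, imPart_ofReIm_mul_matE_mul, matE]
  simp [fromCols_mul_fromBlocks, transpose_fromCols, fromCols_mul_fromRows]

/-- The Gram matrix of the rows `rowB` is `G₂₂`. -/
theorem rowB_mul_matE_mul :
    s.rowB R Δ * matE (QExt R Δ) i m * (s.rowB R Δ)ᴴ = ofReIm (s.G₂₂ R Δ) 0 := by
  have h : s.rowB R Δ * matE (QExt R Δ) i m * (s.rowB R Δ)ᴴ = (s.matG R Δ).toBlocks₂₂ := by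
    rw [matG, mu₁_eq, fromRows_mul, conjTranspose_fromRows_eq_fromCols_conjTranspose,
      fromRows_mul_fromCols, toBlocks_fromBlocks₂₂]
  have h0 : imPart (s.matG R Δ).toBlocks₂₂ = 0 :=
    congrArg toBlocks₂₂ (s.imPart_matG R Δ)
  rw [h, ← ofReIm_rePart h0]
  rfl

theorem G₂₂_transpose : (s.G₂₂ R Δ)ᵀ = s.G₂₂ R Δ := by
  have h : (s.rowB R Δ * matE (QExt R Δ) i m * (s.rowB R Δ)ᴴ)ᴴ =
      s.rowB R Δ * matE (QExt R Δ) i m * (s.rowB R Δ)ᴴ :=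
    isHermitian_mul_mul_conjTranspose _ matE_conjTranspose
  rw [rowB_mul_matE_mul, ofReIm_conjTranspose] at h
  exact (ofReIm_injective h).1

theorem sigma_mul_J_mul (p : ℕ) :
    s.sigma R p * Matrix.J (Fin i ⊕ Fin m) R * (s.sigma R p)ᵀ =
      (p : R) ^ 2 • Matrix.J (Fin i ⊕ Fin m) R := by
  have h := s.rel_map R
  simp only [sigma, Matrix.J, fromBlocks_multiply, fromBlocks_transpose, fromBlocks_smul,
    fromBlocks_neg, ← fromBlocks_one]
  have h' : -(s.CR R * (s.AR R)ᵀ) + s.UR R + (s.AR R * (s.CR R)ᵀ - (s.UR R)ᵀ) = 0 := by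
    rw [← sub_eq_zero] at h
    rw [← neg_eq_zero, ← h]
    abel
  simp [fromBlocks_multiply, fromBlocks_add, smul_smul, pow_two, sub_eq_add_neg] at h' ⊢
  rw [h', fromBlocks_zero]

end OpenElement

/-! ### Reduction modulo `p` -/

section Reduction

variable {R R' : Type*} [CommRing R] [CommRing R'] (f : R →+* R') {Δ : ℤ} {ι κ : Type*} {i m : ℕ}

theorem ofReIm_map_mapQExt (X Y : Matrix ι κ R) :
    (ofReIm (Δ := Δ) X Y).map (mapQExt f Δ) = ofReIm (X.map f) (Y.map f) := rfl

theorem neg_map (M : Matrix ι κ R) : (-M).map f = -M.map f := by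
  ext; simp

theorem matE_map : (matE R i m).map f = matE R' i m := by
  rw [matE, fromBlocks_map, neg_map]
  simp [matE]

theorem smul_map (c : R) (M : Matrix ι κ R) : (c • M).map f = f c • M.map f := by
  ext; simp

theorem alpha_map (γ : Matrix (Fin i ⊕ Fin m) (Fin i ⊕ Fin m) (QExt R Δ)) :
    (alpha γ).map f = alpha (γ.map (mapQExt f Δ)) := by
  obtain ⟨X, Y, rfl⟩ : ∃ X Y, γ = ofReIm X Y := ⟨_, _, (ofReIm_rePart_imPart γ).symm⟩
  rw [alpha, alpha, ofReIm_map_mapQExt, fromBlocks_map, neg_map, smul_map]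
  simp only [rePart_ofReIm, imPart_ofReIm, Matrix.map_mul, matE_map, map_intCast]

theorem mem_GU_map {γ : Matrix (Fin i ⊕ Fin m) (Fin i ⊕ Fin m) (QExt R Δ)} (h : γ ∈ GU R Δ i m) :
    γ.map (mapQExt f Δ) ∈ GU R' Δ i m := by
  obtain ⟨c, hc⟩ := h
  refine ⟨Units.map f c, ?_⟩
  obtain ⟨X, Y, rfl⟩ : ∃ X Y, γ = ofReIm X Y := ⟨_, _, (ofReIm_rePart_imPart γ).symm⟩
  have h' := congrArg (fun M => M.map (mapQExt f Δ)) hc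
  simp only [matE_eq_ofReIm, smul_ofReIm, ofReIm_conjTranspose, Matrix.map_mul, ofReIm_map_mapQExt,
    smul_map, neg_map, transpose_map, matE_map, smul_zero, Matrix.map_zero _ (map_zero f)] at h' ⊢
  simpa using h'

namespace OpenElement

variable (s : OpenElement i m)

theorem AR_map : (s.AR R).map f = s.AR R' := by ext; simp [AR]

theorem CR_map : (s.CR R).map f = s.CR R' := by ext; simp [CR]

theorem UR_map : (s.UR R).map f = s.UR R' := by ext; simp [UR]

theorem sigma_map (p : ℕ) : (s.sigma R p).map f = s.sigma R' p := by
  rw [sigma, sigma, ← s.AR_map f, ← s.CR_map f, ← s.UR_map f]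
  ext ((a | a) | (a | a)) ((b | b) | (b | b)) <;> simp [one_apply, apply_ite f]

theorem mu₁_map : (s.mu₁ R Δ).map (mapQExt f Δ) = s.mu₁ R' Δ := by
  rw [mu₁, mu₁, ofReIm_map_mapQExt, ← s.AR_map f, ← s.CR_map f, ← s.UR_map f]
  congr 1 <;> ext (a | a) (b | b) <;> simp [one_apply, apply_ite f]

theorem mu₂_map : (s.mu₂ R Δ).map (mapQExt f Δ) = s.mu₂ R' Δ := by
  rw [mu₂, mu₂, ofReIm_map_mapQExt, ← s.AR_map f, ← s.CR_map f, ← s.UR_map f]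
  congr 1 <;> ext (a | a) (b | b) <;> simp [one_apply, apply_ite f]

theorem rowB_map : (s.rowB R Δ).map (mapQExt f Δ) = s.rowB R' Δ := by
  have h := s.mu₁_map f (Δ := Δ)
  rw [mu₁_eq, mu₁_eq, fromRows_map] at h
  exact (fromRows_inj h).2

theorem G₂₂_map : (s.G₂₂ R Δ).map f = s.G₂₂ R' Δ := by
  have h := congrArg (fun M => M.map (mapQExt f Δ)) (s.rowB_mul_matE_mul R Δ)
  have hH : ((s.rowB R Δ)ᴴ).map (mapQExt f Δ) = (s.rowB R' Δ)ᴴ := by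
    rw [← s.rowB_map f]
    ext <;> simp [mapQExt]
  simp only [Matrix.map_mul, matE_eq_ofReIm, ofReIm_map_mapQExt, matE_map, hH, rowB_map,
    Matrix.map_zero _ (map_zero f)] at h
  rw [← matE_eq_ofReIm, rowB_mul_matE_mul] at h
  exact (ofReIm_injective h).1.symm

end OpenElement

end Reduction

/-! ### Nondegeneracy of `G₂₂` on the stratum -/

section Nondegenerate

variable {k : Type*} [Field k] {Δ : ℤ} {i m : ℕ}

theorem eq_zero_of_mul_eq_zero_of_rank_eq {X : Matrix (Fin i) (Fin i) k} (hX : X.rank = i)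
    {v : Fin i → k} (hv : X *ᵥ v = 0) : v = 0 := by
  have hsurj : Function.Surjective X.mulVecLin := by
    rw [← LinearMap.range_eq_top]
    exact Submodule.eq_top_of_finrank_eq (hX.trans (by simp))
  exact LinearMap.injective_iff_surjective.2 hsurj (by simpa using hv)

/-- Let `b` span a real subspace with real Gram matrix `H`, orthogonal to `a` and `c` for the
symplectic form, and suppose that modulo the complex span of `b` the rows `c` are `X₁ a`
with `im X₁` invertible. A vector in the radical of `H` pairs with `a` to a real vector `w` such that
`X₁ w` is real too; hence `w = 0`, so the vector is orthogonal to everything and vanishes. -/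
theorem det_ne_zero_of_rank_imPart {a c : Matrix (Fin i) (Fin i ⊕ Fin m) (QExt k Δ)}
    {b : Matrix (Fin m) (Fin i ⊕ Fin m) (QExt k Δ)} {H : Matrix (Fin m) (Fin m) k}
    (hH : b * matE (QExt k Δ) i m * bᴴ = ofReIm H 0)
    (ha : imPart (a * matE (QExt k Δ) i m * bᴴ) = 0)
    (hc : imPart (c * matE (QExt k Δ) i m * bᴴ) = 0)
    (hdet : IsUnit (fromRows a b).det)
    {X₁ : Matrix (Fin i) (Fin i) (QExt k Δ)} {X₂ : Matrix (Fin i) (Fin m) (QExt k Δ)}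
    (hcab : c = X₁ * a + X₂ * b) (hrank : (imPart X₁).rank = i) : H.det ≠ 0 := by
  intro h0
  obtain ⟨v, hv0, hv⟩ := exists_mulVec_eq_zero_iff.2 h0
  apply hv0
  let V : Matrix (Fin m) Unit k := replicateCol Unit v
  have hHV : H * V = 0 := by rw [← replicateCol_mulVec, hv, replicateCol_zero]
  set Q := rePart (a * matE (QExt k Δ) i m * bᴴ) with hQ
  set Q' := rePart (c * matE (QExt k Δ) i m * bᴴ) with hQ'
  have hac : X₁ * ofReIm (Δ := Δ) Q 0 + X₂ * ofReIm (Δ := Δ) H 0 = ofReIm (Δ := Δ) Q' 0 := by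
    rw [hQ, hQ', ofReIm_rePart ha, ofReIm_rePart hc, ← hH, hcab]
    simp only [Matrix.add_mul, Matrix.mul_assoc]
  have him : imPart X₁ * (Q * V) = 0 := by
    have h := congrArg (fun M => imPart (M * ofReIm (Δ := Δ) V 0)) hac
    simp only [Matrix.add_mul, Matrix.mul_assoc] at h
    rw [ofReIm_mul, ofReIm_mul, ofReIm_mul, hHV] at h
    simpa [ofReIm_zero, imPart_mul_ofReIm_zero] using h
  have hQV : Q * V = 0 := by
    have h1 : Q * V = replicateCol Unit (Q *ᵥ v) := (replicateCol_mulVec _ _).symm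
    rw [h1, ← replicateCol_mulVec] at him
    rw [h1, eq_zero_of_mul_eq_zero_of_rank_eq hrank ((replicateCol_eq_zero _).1 him), replicateCol_zero]
  have hM : fromRows a b * (matE (QExt k Δ) i m * (bᴴ * ofReIm (Δ := Δ) V 0)) = 0 := by
    have e1 : a * (matE (QExt k Δ) i m * (bᴴ * ofReIm (Δ := Δ) V 0)) = 0 := by
      rw [← Matrix.mul_assoc, ← Matrix.mul_assoc, ← ofReIm_rePart ha, ← hQ, ofReIm_mul, hQV]
      simp [ofReIm_zero]
    have e2 : b * (matE (QExt k Δ) i m * (bᴴ * ofReIm (Δ := Δ) V 0)) = 0 := by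
      rw [← Matrix.mul_assoc, ← Matrix.mul_assoc, hH, ofReIm_mul, hHV]
      simp [ofReIm_zero]
    rw [fromRows_mul, e1, e2, fromRows_zero]
  have hbV : bᴴ * ofReIm (Δ := Δ) V 0 = 0 := by
    have h1 := congrArg (fun N => matE (QExt k Δ) i m * ((fromRows a b)⁻¹ * N)) hM
    rwa [← Matrix.mul_assoc (fromRows a b)⁻¹, nonsing_inv_mul _ hdet, Matrix.one_mul,
      ← Matrix.mul_assoc, matE_mul_matE, Matrix.one_mul, Matrix.mul_zero, Matrix.mul_zero] at h1
  have hVb : fromCols (0 : Matrix Unit (Fin i) (QExt k Δ)) (ofReIm (Δ := Δ) Vᵀ 0) * fromRows a b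
      = 0 := by
    have h1 := congrArg conjTranspose hbV
    rw [conjTranspose_mul, conjTranspose_conjTranspose, ofReIm_conjTranspose] at h1
    rw [fromCols_mul_fromRows, Matrix.zero_mul, zero_add]
    simpa using h1
  have hV : fromCols (0 : Matrix Unit (Fin i) (QExt k Δ)) (ofReIm (Δ := Δ) Vᵀ 0) = 0 := by
    have h1 := congrArg (fun N => N * (fromRows a b)⁻¹) hVb
    simpa [Matrix.mul_assoc, mul_nonsing_inv _ hdet] using h1
  funext j
  exact congrArg QuadraticAlgebra.re (congrFun (congrFun hV ()) (Sum.inr j))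

end Nondegenerate

/-! ### Bases adapted to the rows `rowB` -/

section Stratum

variable {p : ℕ} [Fact p.Prime] {Δ : ℤ} {i m : ℕ}

theorem OpenElement.det_G₂₂_ne_zero (hinert : legendreSym p (-Δ) = -1) {s : OpenElement i m}
    (hs : s ∈ stratum p Δ i m i) : (s.G₂₂ (ZMod p) Δ).det ≠ 0 := by
  rcases hs with ⟨hdet, X₁, X₂, h, hrank⟩ | ⟨-, hdet, X₁, X₂, h, hrank⟩ <;>
    rw [s.mu₁_eq, s.mu₂_eq, fromBlocks_mul_fromRows] at h
  · rw [s.mu₁_eq] at hdet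
    exact det_ne_zero_of_rank_imPart (s.rowB_mul_matE_mul _ Δ) (s.imPart_rowA_rowB _ Δ)
      (s.imPart_rowC_rowB _ Δ) (isUnit_zmod_of_ne_zero hinert hdet) (fromRows_inj h).1 hrank
  · rw [s.mu₂_eq] at hdet
    exact det_ne_zero_of_rank_imPart (s.rowB_mul_matE_mul _ Δ) (s.imPart_rowC_rowB _ Δ)
      (s.imPart_rowA_rowB _ Δ) (isUnit_zmod_of_ne_zero hinert hdet) (fromRows_inj h).1 hrank

theorem OpenElement.isUnit_det_G₂₂ (hinert : legendreSym p (-Δ) = -1) {s : OpenElement i m}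
    (hs : s ∈ stratum p Δ i m i) : IsUnit (s.G₂₂ ℤ_[p] Δ).det := by
  rw [isUnit_iff_toZMod_ne_zero, RingHom.map_det, RingHom.mapMatrix_apply, s.G₂₂_map]
  exact s.det_G₂₂_ne_zero hinert hs

/-- The rows `rowB` extend to a basis of `ℤ_{p²}^g`. -/
theorem OpenElement.exists_isUnit_det_fromRows (hinert : legendreSym p (-Δ) = -1)
    {s : OpenElement i m} (hs : s ∈ stratum p Δ i m i) :
    ∃ a, IsUnit (fromRows a (s.rowB ℤ_[p] Δ)).det := by
  rcases hs with ⟨hdet, -⟩ | ⟨-, hdet, -⟩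
  · refine ⟨s.rowA ℤ_[p] Δ, ?_⟩
    rw [← s.mu₁_eq, isUnit_iff_mapQExt_ne_zero hinert, RingHom.map_det, RingHom.mapMatrix_apply,
      s.mu₁_map]
    exact hdet
  · refine ⟨s.rowC ℤ_[p] Δ, ?_⟩
    rw [← s.mu₂_eq, isUnit_iff_mapQExt_ne_zero hinert, RingHom.map_det, RingHom.mapMatrix_apply,
      s.mu₂_map]
    exact hdet

/-- Over `ℤ_{p²}`, rows `b` with a real unimodular Gram matrix `H` that extend to a basis extend to one
with Gram matrix `diag(1, H)`: project the other basis vectors to the orthogonal complement of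
`b`, whose hermitian form is unimodular and therefore standard. -/
theorem exists_basis_gram_eq (hp2 : p ≠ 2) (hinert : legendreSym p (-Δ) = -1)
    {a : Matrix (Fin i) (Fin i ⊕ Fin m) (QExt ℤ_[p] Δ)}
    {b : Matrix (Fin m) (Fin i ⊕ Fin m) (QExt ℤ_[p] Δ)} {H : Matrix (Fin m) (Fin m) ℤ_[p]}
    (hH : b * matE (QExt ℤ_[p] Δ) i m * bᴴ = ofReIm H 0) (hHdet : IsUnit H.det)
    (hdet : IsUnit (fromRows a b).det) :
    ∃ n : Matrix (Fin i) (Fin i ⊕ Fin m) (QExt ℤ_[p] Δ), IsUnit (fromRows n b).det ∧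
      fromRows n b * matE (QExt ℤ_[p] Δ) i m * (fromRows n b)ᴴ = fromBlocks 1 0 0 (ofReIm H 0) := by
  set E := matE (QExt ℤ_[p] Δ) i m with hE
  have hHu := isUnit_det_ofReIm (Δ := Δ) hHdet
  set h : Matrix (Fin m) (Fin m) (QExt ℤ_[p] Δ) := ofReIm H 0 with hh
  set n₀ := a - a * E * bᴴ * h⁻¹ * b with hn₀
  have hn₀b : n₀ * E * bᴴ = 0 := by
    rw [hn₀, Matrix.sub_mul, Matrix.sub_mul, Matrix.mul_assoc _ b, Matrix.mul_assoc _ (b * E), hH,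
      Matrix.mul_assoc _ h⁻¹, nonsing_inv_mul _ hHu, Matrix.mul_one, sub_self]
  have hbn₀ : b * E * n₀ᴴ = 0 := by
    have := congrArg conjTranspose hn₀b
    simpa [conjTranspose_mul, matE_conjTranspose, hE, Matrix.mul_assoc] using this
  have hdet₀ : IsUnit (fromRows n₀ b).det := by
    have e : fromRows n₀ b = fromBlocks 1 (-(a * E * bᴴ * h⁻¹)) 0 1 * fromRows a b := by
      rw [fromBlocks_mul_fromRows]
      simp [hn₀, sub_eq_add_neg]
    rw [e, det_mul, det_fromBlocks_zero₂₁]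
    simpa using hdet
  have hgram : ∀ n : Matrix (Fin i) (Fin i ⊕ Fin m) (QExt ℤ_[p] Δ), fromRows n b * E * (fromRows n b)ᴴ =
      fromBlocks (n * E * nᴴ) (n * E * bᴴ) (b * E * nᴴ) h := fun n => by
    rw [fromRows_mul, conjTranspose_fromRows_eq_fromCols_conjTranspose, fromRows_mul_fromCols, hH]
  have hK : IsUnit (n₀ * E * n₀ᴴ).det := by
    have e := congrArg det (hgram n₀)
    rw [hn₀b, hbn₀, det_fromBlocks_zero₂₁, det_mul, det_mul, det_conjTranspose] at e
    refine isUnit_of_mul_isUnit_left (y := h.det) ?_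
    rw [← e]
    exact (hdet₀.mul isUnit_det_matE).mul hdet₀.star
  obtain ⟨P, hP, hPK⟩ := (starCongruent_one hp2 hinert
    (isHermitian_mul_mul_conjTranspose n₀ matE_conjTranspose) hK).symm.exists_isUnit_det
  refine ⟨P * n₀, ?_, ?_⟩
  · have e : fromRows (P * n₀) b = fromBlocks P 0 0 1 * fromRows n₀ b := by
      rw [fromBlocks_mul_fromRows]
      simp
    rw [e, det_mul, det_fromBlocks_zero₂₁, det_one, mul_one]
    exact hP.mul hdet₀
  · rw [hgram]
    congr 1
    · rw [← hPK, conjTranspose_mul]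
      simp only [Matrix.mul_assoc, hE]
    · rw [Matrix.mul_assoc, Matrix.mul_assoc, ← Matrix.mul_assoc n₀, hn₀b, Matrix.mul_zero]
    · rw [conjTranspose_mul, ← Matrix.mul_assoc, hbn₀, Matrix.zero_mul]

end Stratum

/-! ### D-equivalence and congruence of the Gram matrices -/

section Equivalence

/-- A matrix with `S J Sᵀ = r J` satisfies the corresponding identity for columns as well. -/
theorem J_mul_transpose_mul_J_mul {R ι : Type*} [CommRing R] [IsDomain R] [Fintype ι] [DecidableEq ι]
    {S : Matrix (ι ⊕ ι) (ι ⊕ ι) R} {r : R} (hr : r ≠ 0)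
    (hS : S * Matrix.J ι R * Sᵀ = r • Matrix.J ι R) :
    Matrix.J ι R * Sᵀ * Matrix.J ι R * S = -(r • 1) := by
  have h1 : S * (Matrix.J ι R * Sᵀ * Matrix.J ι R) = -(r • 1) := by
    rw [← Matrix.mul_assoc, ← Matrix.mul_assoc, hS, smul_mul, J_squared, smul_neg]
  have hdet : S.det ≠ 0 := fun h0 => by
    have h2 := congrArg det h1
    rw [det_mul, h0, zero_mul, ← neg_smul, det_smul, det_one, mul_one] at h2
    exact pow_ne_zero _ (neg_ne_zero.2 hr) h2.symm
  have h3 : S.det • (Matrix.J ι R * Sᵀ * Matrix.J ι R * S) = S.det • (-(r • 1)) := by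
    have h4 : S.adjugate * (S * (Matrix.J ι R * Sᵀ * Matrix.J ι R)) * S
        = S.adjugate * (-(r • 1)) * S := by rw [h1]
    rw [← Matrix.mul_assoc S.adjugate, adjugate_mul, smul_mul, Matrix.one_mul, smul_mul] at h4
    rw [h4, Matrix.mul_neg, Matrix.neg_mul, Matrix.mul_smul, Matrix.mul_one, smul_mul, adjugate_mul,
      smul_neg, smul_comm]
  exact smul_right_injective _ hdet h3

theorem imPart_fromBlocks {R ι κ ι' κ' : Type*} [CommRing R] {Δ : ℤ} (A : Matrix ι κ (QExt R Δ))
    (B : Matrix ι κ' (QExt R Δ)) (C : Matrix ι' κ (QExt R Δ)) (D : Matrix ι' κ' (QExt R Δ)) :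
    imPart (fromBlocks A B C D) = fromBlocks (imPart A) (imPart B) (imPart C) (imPart D) :=
  fromBlocks_map _ _ _ _ _

theorem imPart_smul {R ι κ : Type*} [CommRing R] {Δ : ℤ} (r : R) (M : Matrix ι κ (QExt R Δ)) :
    imPart (r • M) = r • imPart M := rfl

theorem smul_conjTranspose {R ι κ : Type*} [CommRing R] {Δ : ℤ} (r : R)
    (M : Matrix ι κ (QExt R Δ)) : (r • M)ᴴ = r • Mᴴ := by
  ext <;> simp

theorem fromRows_mul_mul_fromRows_conjTranspose {R ι κ ι' κ' τ : Type*} [CommRing R] {Δ : ℤ}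
    [Fintype τ] (K L : Matrix τ τ (QExt R Δ)) (A : Matrix ι τ (QExt R Δ)) (B : Matrix κ τ (QExt R Δ))
    (A' : Matrix ι' τ (QExt R Δ)) (B' : Matrix κ' τ (QExt R Δ)) :
    fromRows A B * K * L * (fromRows A' B')ᴴ =
      fromBlocks (A * K * L * A'ᴴ) (A * K * L * B'ᴴ) (B * K * L * A'ᴴ) (B * K * L * B'ᴴ) := by
  rw [fromRows_mul, fromRows_mul, conjTranspose_fromRows_eq_fromCols_conjTranspose,
    fromRows_mul_fromCols]

/-- If the rows `b` of the first family and `b'` of the second have zero symplectic products with each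
other and with the rows `a`, `c` and `a'`, `c'`, then the symplectic products of the rows
`r a`, `b`, `r c`, `r² d` with `r a'`, `b'`, `r c'`, `r² d'` are all divisible by `r²`. -/
theorem exists_imPart_eq_smul {R ι κ τ : Type*} [CommRing R] {Δ : ℤ} [Fintype τ] (r : R)
    {K : Matrix τ τ (QExt R Δ)} {L : Matrix τ τ (QExt R Δ)}
    {a c a' c' : Matrix ι τ (QExt R Δ)} {b d b' d' : Matrix κ τ (QExt R Δ)}
    (hab : imPart (a * K * L * b'ᴴ) = 0) (hcb : imPart (c * K * L * b'ᴴ) = 0)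
    (hba : imPart (b * K * L * a'ᴴ) = 0) (hbb : imPart (b * K * L * b'ᴴ) = 0)
    (hbc : imPart (b * K * L * c'ᴴ) = 0) :
    ∃ Y, imPart (fromRows (fromRows (r • a) b) (fromRows (r • c) (r ^ 2 • d)) * K * L *
      (fromRows (fromRows (r • a') b') (fromRows (r • c') (r ^ 2 • d')))ᴴ) = r ^ 2 • Y := by
  refine ⟨fromBlocks
    (fromBlocks (imPart (a * K * L * a'ᴴ)) 0 0 0)
    (fromBlocks (imPart (a * K * L * c'ᴴ)) (r • imPart (a * K * L * d'ᴴ))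
      0 (imPart (b * K * L * d'ᴴ)))
    (fromBlocks (imPart (c * K * L * a'ᴴ)) 0
      (r • imPart (d * K * L * a'ᴴ)) (imPart (d * K * L * b'ᴴ)))
    (fromBlocks (imPart (c * K * L * c'ᴴ)) (r • imPart (c * K * L * d'ᴴ))
      (r • imPart (d * K * L * c'ᴴ)) (r ^ 2 • imPart (d * K * L * d'ᴴ))), ?_⟩
  simp only [fromRows_mul_mul_fromRows_conjTranspose,
    smul_conjTranspose, imPart_smul, imPart_fromBlocks, smul_mul, Matrix.mul_smul, fromBlocks_smul,
    smul_smul, smul_zero, hab, hcb, hba, hbb, hbc]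
  ring_nf

variable {p : ℕ} [Fact p.Prime] {Δ : ℤ} {i m : ℕ} {s₁ s₂ : OpenElement i m}

/-- An element of `GU` that maps the rows `rowB` of `σ₁` to `ℤ_p`-combinations of those of `σ₂`
gives a D-equivalence. The lattice spanned by the rows of `σ₂` is its own dual up to the factor `p²`,
so that the integrality of `σ₁ α(γ) σ₂⁻¹` can be tested on the symplectic products of the rows of
`σ₁ α(γ)` with those of `σ₂`. -/
theorem dEquiv_of_rowB_mul_eq {γ : Matrix (Fin i ⊕ Fin m) (Fin i ⊕ Fin m) (QExt ℤ_[p] Δ)} {c : ℤ_[p]ˣ}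
    (hγ : γ * matE (QExt ℤ_[p] Δ) i m * γᴴ = (c : ℤ_[p]) • matE (QExt ℤ_[p] Δ) i m)
    {T : Matrix (Fin m) (Fin m) ℤ_[p]} (hT : IsUnit T.det)
    (hb : s₁.rowB ℤ_[p] Δ * γ = ofReIm (Δ := Δ) T 0 * s₂.rowB ℤ_[p] Δ) : DEquiv p Δ s₁ s₂ := by
  set E := matE (QExt ℤ_[p] Δ) i m with hE
  set J := Matrix.J (Fin i ⊕ Fin m) ℤ_[p] with hJ
  set S₁ := s₁.sigma ℤ_[p] p with hS₁
  set S₂ := s₂.sigma ℤ_[p] p with hS₂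
  set X := S₁ * alpha (γ.map star) with hX
  have hstar : (γ.map star).map star = γ := by ext <;> simp
  have hXherm : toHerm (Δ := Δ) X = toHerm (Δ := Δ) S₁ * γ := by
    rw [hX, toHerm_mul_alpha, hstar]
  have hp : (p : ℤ_[p]) ^ 2 ≠ 0 :=
    pow_ne_zero _ (Nat.cast_ne_zero.2 (Fact.out : p.Prime).ne_zero)
  have hXX : X * J * Xᵀ = ((c : ℤ_[p]) * (p : ℤ_[p]) ^ 2) • J := by
    have h := imPart_toHerm (Δ := Δ) X X
    have h' := imPart_toHerm (Δ := Δ) S₁ S₁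
    have e : toHerm (Δ := Δ) X * E * (toHerm (Δ := Δ) X)ᴴ
        = (c : ℤ_[p]) • (toHerm (Δ := Δ) S₁ * E * (toHerm (Δ := Δ) S₁)ᴴ) := by
      rw [hXherm, conjTranspose_mul]
      calc _ = toHerm (Δ := Δ) S₁ * (γ * E * γᴴ) * (toHerm (Δ := Δ) S₁)ᴴ := by
            simp only [Matrix.mul_assoc]
        _ = _ := by rw [hγ, Matrix.mul_smul, smul_mul]
    rw [e] at h
    have e' : imPart ((c : ℤ_[p]) • (toHerm (Δ := Δ) S₁ * E * (toHerm (Δ := Δ) S₁)ᴴ))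
        = (c : ℤ_[p]) • imPart (toHerm (Δ := Δ) S₁ * E * (toHerm (Δ := Δ) S₁)ᴴ) := rfl
    rw [e', h', s₁.sigma_mul_J_mul, smul_neg, neg_inj, smul_smul] at h
    exact h.symm
  obtain ⟨Y, hY⟩ : ∃ Y, X * J * S₂ᵀ = (p : ℤ_[p]) ^ 2 • Y := by
    suffices h : ∃ Y, imPart (toHerm (Δ := Δ) S₁ * γ * E * (toHerm (Δ := Δ) S₂)ᴴ)
        = (p : ℤ_[p]) ^ 2 • Y by
      obtain ⟨Y, hY⟩ := h
      refine ⟨-Y, ?_⟩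
      rw [← hXherm, imPart_toHerm] at hY
      rw [smul_neg, ← hY, neg_neg]
    have hconj : ∀ {ι κ : Type} (M : Matrix ι (Fin i ⊕ Fin m) (QExt ℤ_[p] Δ))
        (N : Matrix κ (Fin i ⊕ Fin m) (QExt ℤ_[p] Δ)), imPart (M * E * Nᴴ) = 0 →
        imPart (N * E * Mᴴ) = 0 := fun M N h => by
      have e : N * E * Mᴴ = (M * E * Nᴴ)ᴴ := by
        simp [conjTranspose_mul, hE, matE_conjTranspose, Matrix.mul_assoc]
      rw [e, imPart_conjTranspose, h, transpose_zero, neg_zero]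
    have hbb : imPart (s₂.rowB ℤ_[p] Δ * E * (s₂.rowB ℤ_[p] Δ)ᴴ) = 0 := by
      rw [hE, s₂.rowB_mul_matE_mul, imPart_ofReIm]
    -- Products of the rows `rowB` of `σ₁`, moved by `γ`, with the rows of `σ₂`.
    have left : ∀ {κ : Type} (N : Matrix κ (Fin i ⊕ Fin m) (QExt ℤ_[p] Δ)),
        imPart (s₂.rowB ℤ_[p] Δ * E * Nᴴ) = 0 → imPart (s₁.rowB ℤ_[p] Δ * γ * E * Nᴴ) = 0 :=
      fun N h => by
        rw [hb, Matrix.mul_assoc, Matrix.mul_assoc, imPart_ofReIm_zero_mul, ← Matrix.mul_assoc, h,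
          Matrix.mul_zero]
    -- Products of the rows of `σ₁`, moved by `γ`, with the rows `rowB` of `σ₂`.
    have right : ∀ {κ : Type} (M : Matrix κ (Fin i ⊕ Fin m) (QExt ℤ_[p] Δ)),
        imPart (M * E * (s₁.rowB ℤ_[p] Δ)ᴴ) = 0 → imPart (M * γ * E * (s₂.rowB ℤ_[p] Δ)ᴴ) = 0 :=
      fun M h => by
        have e : s₂.rowB ℤ_[p] Δ = ofReIm (Δ := Δ) T⁻¹ 0 * (s₁.rowB ℤ_[p] Δ * γ) := by
          rw [hb, ← Matrix.mul_assoc, ofReIm_mul, nonsing_inv_mul _ hT]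
          simp [ofReIm_one]
        rw [e, conjTranspose_mul, conjTranspose_mul, ofReIm_conjTranspose, transpose_zero, neg_zero]
        have e' : M * γ * E * (γᴴ * (s₁.rowB ℤ_[p] Δ)ᴴ * ofReIm (Δ := Δ) T⁻¹ᵀ 0) =
            (c : ℤ_[p]) • (M * E * (s₁.rowB ℤ_[p] Δ)ᴴ * ofReIm (Δ := Δ) T⁻¹ᵀ 0) := by
          calc _ = M * (γ * E * γᴴ) * (s₁.rowB ℤ_[p] Δ)ᴴ * ofReIm (Δ := Δ) T⁻¹ᵀ 0 := by
                simp only [Matrix.mul_assoc]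
            _ = _ := by rw [hγ, Matrix.mul_smul, smul_mul, smul_mul]
        rw [e', imPart_smul, imPart_mul_ofReIm_zero, h, Matrix.zero_mul, smul_zero]
    rw [s₁.toHerm_sigma, s₂.toHerm_sigma]
    exact exists_imPart_eq_smul _ (right _ (s₁.imPart_rowA_rowB ℤ_[p] Δ))
      (right _ (s₁.imPart_rowC_rowB ℤ_[p] Δ)) (left _ (hconj _ _ (s₂.imPart_rowA_rowB ℤ_[p] Δ)))
      (left _ hbb) (left _ (hconj _ _ (s₂.imPart_rowC_rowB ℤ_[p] Δ)))
  have hκ : X = -(Y * J) * S₂ := by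
    refine smul_right_injective _ hp ?_
    change (p : ℤ_[p]) ^ 2 • X = (p : ℤ_[p]) ^ 2 • (-(Y * J) * S₂)
    calc (p : ℤ_[p]) ^ 2 • X = -(X * (J * S₂ᵀ * J * S₂)) := by
          rw [J_mul_transpose_mul_J_mul hp (s₂.sigma_mul_J_mul ℤ_[p] p)]
          simp
      _ = -((X * J * S₂ᵀ) * J * S₂) := by simp only [Matrix.mul_assoc]
      _ = (p : ℤ_[p]) ^ 2 • (-(Y * J) * S₂) := by
          rw [hY]
          simp
  refine ⟨γ.map star, ⟨c, mem_GU_map_star hγ⟩, -(Y * J), ⟨c, ?_⟩, hκ⟩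
  refine smul_right_injective _ hp ?_
  change (p : ℤ_[p]) ^ 2 • _ = (p : ℤ_[p]) ^ 2 • _
  rw [smul_smul, mul_comm, ← hXX, hκ, transpose_mul]
  calc (p : ℤ_[p]) ^ 2 • (-(Y * J) * J * (-(Y * J))ᵀ)
      = -(Y * J) * (S₂ * J * S₂ᵀ) * (-(Y * J))ᵀ := by
        rw [s₂.sigma_mul_J_mul ℤ_[p] p, Matrix.mul_smul, smul_mul]
    _ = -(Y * J) * S₂ * J * (S₂ᵀ * (-(Y * J))ᵀ) := by simp only [Matrix.mul_assoc]

/-- A similarity of the real forms `G₂₂` extends to an element of `GU`, because the orthogonal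
complements are standard and every unit is a norm. -/
theorem dEquiv_of_congruent (hp2 : p ≠ 2) (hinert : legendreSym p (-Δ) = -1)
    (h₁ : s₁ ∈ stratum p Δ i m i) (h₂ : s₂ ∈ stratum p Δ i m i) {c : ℤ_[p]ˣ}
    {T : Matrix (Fin m) (Fin m) ℤ_[p]} (hT : IsUnit T.det)
    (h : T * s₂.G₂₂ ℤ_[p] Δ * Tᵀ = (c : ℤ_[p]) • s₁.G₂₂ ℤ_[p] Δ) : DEquiv p Δ s₁ s₂ := by
  set E := matE (QExt ℤ_[p] Δ) i m with hE
  obtain ⟨a₁, ha₁⟩ := s₁.exists_isUnit_det_fromRows hinert h₁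
  obtain ⟨a₂, ha₂⟩ := s₂.exists_isUnit_det_fromRows hinert h₂
  obtain ⟨n₁, hn₁, hg₁⟩ := exists_basis_gram_eq hp2 hinert (s₁.rowB_mul_matE_mul ℤ_[p] Δ)
    (OpenElement.isUnit_det_G₂₂ hinert h₁) ha₁
  obtain ⟨n₂, -, hg₂⟩ := exists_basis_gram_eq hp2 hinert (s₂.rowB_mul_matE_mul ℤ_[p] Δ)
    (OpenElement.isUnit_det_G₂₂ hinert h₂) ha₂
  obtain ⟨z, hz⟩ := exists_mul_star_eq hp2 hinert c.isUnit
  set F₁ := fromRows n₁ (s₁.rowB ℤ_[p] Δ) with hF₁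
  set F₂ := fromRows n₂ (s₂.rowB ℤ_[p] Δ) with hF₂
  let D : Matrix (Fin i ⊕ Fin m) (Fin i ⊕ Fin m) (QExt ℤ_[p] Δ) :=
    fromBlocks (z • 1) 0 0 (ofReIm (Δ := Δ) T 0)
  have hFγ : F₁ * (F₁⁻¹ * D * F₂) = D * F₂ := by
    rw [← Matrix.mul_assoc, ← Matrix.mul_assoc, mul_nonsing_inv _ hn₁, Matrix.one_mul]
  refine dEquiv_of_rowB_mul_eq (γ := F₁⁻¹ * D * F₂) (c := c) ?_ hT ?_
  · have hD : D * (F₂ * E * F₂ᴴ) * Dᴴ = (c : ℤ_[p]) • (F₁ * E * F₁ᴴ) := by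
      rw [hg₁, hg₂]
      simp only [D, fromBlocks_multiply, fromBlocks_conjTranspose, fromBlocks_smul]
      congr 1
      · simp only [Matrix.mul_one, Matrix.mul_zero, Matrix.zero_mul, add_zero, conjTranspose_smul,
          conjTranspose_one, Matrix.mul_smul, smul_smul, mul_comm (star z) z, hz, algebraMap_smul]
      · simp
      · simp
      · simp [ofReIm_conjTranspose, ofReIm_mul, smul_ofReIm, h]
    have hF : F₁⁻¹ * F₁ = 1 := nonsing_inv_mul _ hn₁
    have hF' : F₁ᴴ * F₁⁻¹ᴴ = 1 := by rw [← conjTranspose_mul, hF, conjTranspose_one]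
    calc F₁⁻¹ * D * F₂ * E * (F₁⁻¹ * D * F₂)ᴴ = F₁⁻¹ * (D * (F₂ * E * F₂ᴴ) * Dᴴ) * F₁⁻¹ᴴ := by
          simp only [conjTranspose_mul, Matrix.mul_assoc]
      _ = (c : ℤ_[p]) • (F₁⁻¹ * F₁ * E * (F₁ᴴ * F₁⁻¹ᴴ)) := by
          rw [hD, Matrix.mul_smul, smul_mul]
          simp only [Matrix.mul_assoc]
      _ = (c : ℤ_[p]) • E := by rw [hF, hF', Matrix.one_mul, Matrix.mul_one]
  · have h3 : F₁ * (F₁⁻¹ * D * F₂) = D * F₂ := hFγ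
    rw [hF₁, fromRows_mul, ← hF₁, hF₂, fromBlocks_mul_fromRows, ← hF₂] at h3
    simpa using (fromRows_inj h3).2

/-- If `p = 0` in `R`, then the rows of `σ` other than `rowB` vanish, and `σ₁ α(γ) = κ σ₂` becomes a
relation between the rows `rowB`. -/
theorem exists_congr_of_sigma_mul_alpha_eq {R : Type*} [CommRing R] {p : ℕ} (hp : (p : R) = 0)
    {γ : Matrix (Fin i ⊕ Fin m) (Fin i ⊕ Fin m) (QExt R Δ)} (hγ : γ ∈ GU R Δ i m)
    {κ : Matrix ((Fin i ⊕ Fin m) ⊕ (Fin i ⊕ Fin m)) ((Fin i ⊕ Fin m) ⊕ (Fin i ⊕ Fin m)) R}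
    (h : s₁.sigma R p * alpha γ = κ * s₂.sigma R p) :
    ∃ (c : Rˣ) (T : Matrix (Fin m) (Fin m) R),
      (c : R) • s₁.G₂₂ R Δ = T * s₂.G₂₂ R Δ * Tᵀ := by
  obtain ⟨c, hc⟩ := hγ
  set E := matE (QExt R Δ) i m with hE
  have hc' := mem_GU_map_star hc
  set T := κ.toBlocks₁₁.toBlocks₂₂
  have hb : s₁.rowB R Δ * γ.map star = ofReIm (Δ := Δ) T 0 * s₂.rowB R Δ := by
    have h' := congrArg (toHerm (Δ := Δ)) h
    have hκ : ofReIm (Δ := Δ) κ 0 = fromBlocks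
        (fromBlocks (ofReIm κ.toBlocks₁₁.toBlocks₁₁ 0) (ofReIm κ.toBlocks₁₁.toBlocks₁₂ 0)
          (ofReIm κ.toBlocks₁₁.toBlocks₂₁ 0) (ofReIm (Δ := Δ) T 0))
        (ofReIm κ.toBlocks₁₂ 0) (ofReIm κ.toBlocks₂₁ 0) (ofReIm κ.toBlocks₂₂ 0) := by
      ext ((a | a) | a) ((b | b) | b) <;> rfl
    rw [toHerm_mul_alpha, toHerm_mul, s₁.toHerm_sigma, s₂.toHerm_sigma, hp, hκ] at h'
    simp only [zero_smul, ne_eq, OfNat.ofNat_ne_zero, not_false_eq_true, zero_pow, fromRows_zero,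
      fromRows_mul, fromBlocks_mul_fromRows, Matrix.mul_zero, add_zero, zero_add] at h'
    exact (fromRows_inj (fromRows_inj h').1).2
  refine ⟨c, T, ?_⟩
  have key : (s₁.rowB R Δ * γ.map star) * E * (s₁.rowB R Δ * γ.map star)ᴴ =
      ofReIm ((c : R) • s₁.G₂₂ R Δ) 0 := by
    calc _ = s₁.rowB R Δ * (γ.map star * E * (γ.map star)ᴴ) * (s₁.rowB R Δ)ᴴ := by
          simp only [conjTranspose_mul, Matrix.mul_assoc]
      _ = (c : R) • (s₁.rowB R Δ * E * (s₁.rowB R Δ)ᴴ) := by rw [hc', Matrix.mul_smul, smul_mul]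
      _ = _ := by rw [hE, s₁.rowB_mul_matE_mul, smul_ofReIm, smul_zero]
  have key' : (s₁.rowB R Δ * γ.map star) * E * (s₁.rowB R Δ * γ.map star)ᴴ =
      ofReIm (T * s₂.G₂₂ R Δ * Tᵀ) 0 := by
    rw [hb]
    calc _ = ofReIm (Δ := Δ) T 0 * (s₂.rowB R Δ * E * (s₂.rowB R Δ)ᴴ) * (ofReIm (Δ := Δ) T 0)ᴴ := by
          simp only [conjTranspose_mul, Matrix.mul_assoc]
      _ = _ := by
          rw [hE, s₂.rowB_mul_matE_mul, ofReIm_conjTranspose, ofReIm_mul, ofReIm_mul]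
          simp
  exact (ofReIm_injective (key.symm.trans key')).1

theorem exists_congr_of_dEquiv (h : DEquiv p Δ s₁ s₂) :
    ∃ (c : (ZMod p)ˣ) (T : Matrix (Fin m) (Fin m) (ZMod p)),
      (c : ZMod p) • s₁.G₂₂ (ZMod p) Δ = T * s₂.G₂₂ (ZMod p) Δ * Tᵀ := by
  obtain ⟨γ, hγ, κ, -, h⟩ := h
  have h' := congrArg (fun M => M.map (PadicInt.toZMod (p := p))) h
  simp only [Matrix.map_mul, OpenElement.sigma_map, alpha_map] at h'
  exact exists_congr_of_sigma_mul_alpha_eq (CharP.cast_eq_zero _ p) (mem_GU_map _ hγ) h'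

end Equivalence

end HeckeSiegel

theorem theorem4p2p15 (p : ℕ) [Fact p.Prime] (hp2 : p ≠ 2)
    (Δ : ℤ) (hΔ : 0 < Δ) (hinert : legendreSym p (-Δ) = -1)
    (g i : ℕ) (hi : i ≤ g)
    (σ₁ σ₂ : HeckeSiegel.OpenElement i (g - i))
    (h₁ : σ₁ ∈ HeckeSiegel.stratum p Δ i (g - i) i)
    (h₂ : σ₂ ∈ HeckeSiegel.stratum p Δ i (g - i) i) :
    (Odd (g - i) → HeckeSiegel.DEquiv p Δ σ₁ σ₂) ∧
    (Even (g - i) →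
      (HeckeSiegel.DEquiv p Δ σ₁ σ₂ ↔
        ∃ c : (ZMod p)ˣ,
          (σ₁.G₂₂ (ZMod p) Δ).det / (σ₂.G₂₂ (ZMod p) Δ).det = (c : ZMod p) ^ 2)) := by
  generalize g - i = m at *
  have hd₁ := HeckeSiegel.OpenElement.isUnit_det_G₂₂ hinert h₁
  have hd₂ := HeckeSiegel.OpenElement.isUnit_det_G₂₂ hinert h₂
  have hr₁ := HeckeSiegel.OpenElement.det_G₂₂_ne_zero hinert h₁
  have hr₂ := HeckeSiegel.OpenElement.det_G₂₂_ne_zero hinert h₂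
  have construct : ∀ (c : ℤ_[p]ˣ) (v : ℤ_[p]),
      (c : ℤ_[p]) ^ m * (σ₁.G₂₂ ℤ_[p] Δ).det = v ^ 2 * (σ₂.G₂₂ ℤ_[p] Δ).det →
      HeckeSiegel.DEquiv p Δ σ₁ σ₂ := fun c v h => by
    have hdet : ((c : ℤ_[p]) • σ₁.G₂₂ ℤ_[p] Δ).det = (c : ℤ_[p]) ^ m * (σ₁.G₂₂ ℤ_[p] Δ).det := by
      rw [Matrix.det_smul, Fintype.card_fin]
    obtain ⟨T, hT, hTG⟩ := HeckeSiegel.exists_mul_mul_transpose_eq hp2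
      (M := (c : ℤ_[p]) • σ₁.G₂₂ ℤ_[p] Δ) (N := σ₂.G₂₂ ℤ_[p] Δ) (v := v)
      (by rw [Matrix.transpose_smul, σ₁.G₂₂_transpose]) (σ₂.G₂₂_transpose _ _)
      (by rw [hdet]; exact (c.isUnit.pow m).mul hd₁) hd₂ (by rw [hdet, h])
    exact HeckeSiegel.dEquiv_of_congruent hp2 hinert h₁ h₂ hT hTG
  refine ⟨?_, fun hm => ⟨fun h => ?_, ?_⟩⟩
  · -- In odd rank, scaling by `c = det G₁ · det G₂` equates the discriminants up to squares.
    rintro ⟨n, rfl⟩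
    obtain ⟨u₁, hu₁⟩ := hd₁
    obtain ⟨u₂, hu₂⟩ := hd₂
    refine construct (u₁ * u₂) (((u₁ : ℤ_[p]) * u₂) ^ n * u₁) ?_
    rw [← hu₁, ← hu₂]
    push_cast
    ring
  · obtain ⟨n, rfl⟩ := hm
    obtain ⟨c, T, hT⟩ := HeckeSiegel.exists_congr_of_dEquiv h
    have hdet := congrArg Matrix.det hT
    rw [Matrix.det_smul, Fintype.card_fin, Matrix.det_mul, Matrix.det_mul, Matrix.det_transpose]
      at hdet
    have hTdet : T.det ≠ 0 := fun h0 => by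
      rw [h0, zero_mul, zero_mul] at hdet
      exact mul_ne_zero (pow_ne_zero _ c.ne_zero) hr₁ hdet
    refine ⟨Units.mk0 T.det hTdet * (c ^ n)⁻¹, ?_⟩
    have hc := c.ne_zero
    rw [div_eq_iff hr₂]
    push_cast
    rw [Units.val_mk0]
    field_simp
    linear_combination hdet
  · rintro ⟨c, hc⟩
    set x := (σ₁.G₂₂ ℤ_[p] Δ).det with hx
    obtain ⟨u₂, hu₂⟩ := hd₂
    have hmap : ∀ s : HeckeSiegel.OpenElement i m,
        PadicInt.toZMod (s.G₂₂ ℤ_[p] Δ).det = (s.G₂₂ (ZMod p) Δ).det := fun s => by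
      rw [RingHom.map_det, RingHom.mapMatrix_apply, s.G₂₂_map]
    obtain ⟨v, hv⟩ := HeckeSiegel.exists_sq_eq_of_toZMod hp2 (u := x * ↑u₂⁻¹) c.ne_zero (by
      rw [← hc, eq_div_iff hr₂, ← hmap, ← hmap, ← map_mul, ← hu₂, Units.inv_mul_cancel_right])
    refine construct 1 v ?_
    rw [hv, ← hu₂, Units.inv_mul_cancel_right]
    simp
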